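/- For $a>0$ let $\mathfrak D(a)=\{t\in\mathbb C:\operatorname{dist}(t,(0,+\infty))<a\}$ and let $\gamma(a)=\{t\in\mathbb C:\operatorname{dist}(t,(0,+\infty))=a\}$ be its boundary, oriented counterclockwise (from $+\infty+ia$ to $+\infty-ia$). For $a>0$, $R\ge 0$ let $H(a,R)$ be the space of functions $F$ such that (1) $F$ is analytic in $\mathfrak D(a)$; (2) $F$ has exponential growth at infinity in $\mathfrak D(a)$, that is, for every $0<A<a$ there are constants $C,\sigma$ with $|F(t)|\le Ce^{\sigma|t|}$ on $\mathfrak D(A)$; (3) $\|F\|_{r,A}=\int_{\gamma(A)}e^{-r|t|}|F(t)|\,|dt|<\infty$ for all $r>R$ and $0<A<a$. Put $H=\bigcup_{a>0,R\ge0}H(a,R)$. For $F\in H$ and $\Re\alpha>-1$ let $$\mathcal L\{F\}(\zeta)=\zeta\int_0^{+\infty}e^{-\zeta t}F(t)\,dt,\qquad \mathcal L_\alpha\{F\}(\zeta)=\zeta^{\alpha}\mathcal L\{t^\alpha F(t)\}(\zeta)$$ for $\Re\zeta$ large enough (principal powers), and let $\mathcal D_\alpha F=\mathcal L^{-1}\mathcal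 L_\alpha F$, with $\mathcal L^{-1}$ taking values in $H$, be the fractional derivative of $F$ of order $\alpha$. **Theorem 6.** Let $a>0$, $R\ge0$, $\Re\alpha>-1$, $F\in H(a,R)$ and $F(t,\alpha)=\mathcal D_\alpha\{F(t)\}$. (i) For all $r>R$, $0<A<a$ and $t\in\mathfrak D(A)$, $$F(t,\alpha)=\sum_{k=0}^\infty\frac{\Gamma(\alpha+k+1)}{(k!)^2}(rt)^kf_k(\alpha,r,t),\qquad f_k(\alpha,r,t)=\frac1{2\pi i}\int_{\gamma(A)}{}_2F_1\Bigl(\alpha+k+1,1;k+1;\frac t\xi\Bigr)\frac{F(\xi)e^{-r\xi}}{\xi}\,d\xi,$$ where ${}_2F_1(\,\cdot\,;z)$ is the principal branch, analytic in $\mathbb C\setminus[1,+\infty)$. (ii) The integrals defining $f_k$ and the sum in (i) are absolutely convergent, and the fractional derivative is well defined in $H(a,R)$: $F(\cdot,\alpha)\in H(a,R)$ and $\mathcal L\{F(\cdot,\alpha)\}(\zeta)=\mathcal L_\alpha\{F\}(\zeta)$ for $\Re\zeta>R$. -/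

import Mathlib

noncomputable section

namespace FracCalc

open MeasureTheory Set Complex

/-- The region `𝔇(a)` of all points whose distance to the half-line `(0, +∞)` is less than `a`. -/
def region (a : ℝ) : Set ℂ :=
  {t : ℂ | Metric.infDist t ((fun x : ℝ => (x : ℂ)) '' Ioi 0) < a}

/-- Absolute convergence `∫_{γ(A)} |g(ξ)| |dξ| < ∞`, where `γ(A)`, the set of points at distance
`A` from `(0, +∞)`, consists of the rays `x + iA` and `x - iA` (`x > 0`) and of the left half
of the circle `|ξ| = A`. -/
def AbsConvergent (A : ℝ) (g : ℂ → ℂ) : Prop :=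
  IntegrableOn (fun x : ℝ => g (x + A * I)) (Ioi 0) ∧
  IntegrableOn (fun θ : ℝ => g (A * exp (θ * I))) (Icc (Real.pi / 2) (3 * Real.pi / 2)) ∧
  IntegrableOn (fun x : ℝ => g (x - A * I)) (Ioi 0)

/-- The integral `∫_{γ(A)} g(ξ) dξ`, with `γ(A)` oriented counterclockwise: from `+∞ + iA` to `iA`,
then along the half circle through `-A` to `-iA`, then from `-iA` to `+∞ - iA`. -/
def contourIntegral (A : ℝ) (g : ℂ → ℂ) : ℂ :=
  -(∫ x in Ioi (0 : ℝ), g (x + A * I)) +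
  (∫ θ in (Real.pi / 2)..(3 * Real.pi / 2), g (A * exp (θ * I)) * (A * I * exp (θ * I))) +
  (∫ x in Ioi (0 : ℝ), g (x - A * I))

/-- The space `H(a, R)`: functions analytic in `𝔇(a)`, of exponential growth at infinity
(uniformly in every smaller region `𝔇(A)`), with finite norms
`‖F‖_{r,A} = ∫_{γ(A)} e^{-r|t|} |F(t)| |dt|` for all `r > R` and `0 < A < a`.
Only the values of `F` in `𝔇(a)` matter. -/
structure MemH (a R : ℝ) (F : ℂ → ℂ) : Prop where
  analytic : AnalyticOnNhd ℂ F (region a)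
  growth : ∀ A : ℝ, 0 < A → A < a →
    ∃ C σ : ℝ, ∀ t ∈ region A, ‖F t‖ ≤ C * Real.exp (σ * ‖t‖)
  norm_finite : ∀ r : ℝ, R < r → ∀ A : ℝ, 0 < A → A < a →
    AbsConvergent A (fun t => (Real.exp (-r * ‖t‖) : ℂ) * F t)

/-- `𝓛{F}(ζ) = ζ ∫_0^∞ e^{-ζt} F(t) dt`. -/
def laplace (F : ℂ → ℂ) (ζ : ℂ) : ℂ :=
  ζ * ∫ t in Ioi (0 : ℝ), exp (-ζ * t) * F t

/-- `𝓛_α{F}(ζ) = ζ^α 𝓛{t^α F(t)}(ζ)`, with principal powers. -/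
def laplaceAlpha (α : ℂ) (F : ℂ → ℂ) (ζ : ℂ) : ℂ :=
  ζ ^ α * laplace (fun t => t ^ α * F t) ζ

/-- `G`, as an element of `H(a, R)`, is an inverse Laplace transform of `𝓛_α{F}`; the two
transforms are compared in some right half-plane. -/
def IsFracDeriv (α : ℂ) (F : ℂ → ℂ) (a R : ℝ) (G : ℂ → ℂ) : Prop :=
  0 < a ∧ 0 ≤ R ∧ MemH a R G ∧
    ∃ ρ : ℝ, ∀ ζ : ℂ, ρ < ζ.re → laplace G ζ = laplaceAlpha α F ζ

open Classical in
/-- The fractional derivative `𝓓_α F = 𝓛⁻¹ 𝓛_α F`, where `𝓛⁻¹` takes its values in the union `H`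
of the spaces `H(a, R)`. Its value at `t` is that of an element of `H` with transform `𝓛_α F` whose
region contains `t`; by injectivity of `𝓛` it does not depend on the choice of this element. -/
def fracDeriv (α : ℂ) (F : ℂ → ℂ) (t : ℂ) : ℂ :=
  if h : ∃ G : ℂ → ℂ, ∃ a R : ℝ, IsFracDeriv α F a R G ∧ t ∈ region a then h.choose t else 0

/-- The complex plane cut along `[1, +∞)`. -/
def cutPlane : Set ℂ := {z : ℂ | ¬ (1 ≤ z.re ∧ z.im = 0)}

/-- `G` is the analytic continuation of the Gauss series `₂F₁(a, b; c; z)`, `|z| < 1`,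
to the cut plane. -/
def IsGaussBranch (a b c : ℂ) (G : ℂ → ℂ) : Prop :=
  AnalyticOnNhd ℂ G cutPlane ∧
    ∀ z ∈ Metric.ball (0 : ℂ) 1, G z = ordinaryHypergeometric a b c z

open Classical in
/-- The principal branch of the hypergeometric function `₂F₁(a, b; c; z)` on the plane cut along
`[1, +∞)`. -/
def gauss2F1 (a b c z : ℂ) : ℂ :=
  if h : ∃ G : ℂ → ℂ, IsGaussBranch a b c G then h.choose z else 0

/-- The integrand `₂F₁(α+k+1, 1; k+1; t/ξ) F(ξ) e^{-rξ} / ξ`. -/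
def integrand (F : ℂ → ℂ) (α : ℂ) (r : ℝ) (t : ℂ) (k : ℕ) (ξ : ℂ) : ℂ :=
  gauss2F1 (α + k + 1) 1 (k + 1) (t / ξ) * (F ξ * exp (-r * ξ) / ξ)

/-- `f_k(α, r, t)`, the integral of `integrand` over `γ(A)` divided by `2πi`. -/
def coeff (F : ℂ → ℂ) (A : ℝ) (α : ℂ) (r : ℝ) (t : ℂ) (k : ℕ) : ℂ :=
  1 / (2 * Real.pi * I) * contourIntegral A (integrand F α r t k)

/-- The `k`-th term `Γ(α+k+1) / (k!)² (rt)^k f_k(α, r, t)`. -/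
def seriesTerm (F : ℂ → ℂ) (A : ℝ) (α : ℂ) (r : ℝ) (t : ℂ) (k : ℕ) : ℂ :=
  Gamma (α + k + 1) / ((k.factorial : ℂ) ^ 2) * (r * t) ^ k * coeff F A α r t k

end FracCalc

end

/-!
For a function `F` with Taylor coefficients `F_n`, the transform `𝓛_α` multiplies the transform of
`t^n` by `Γ(α+n+1)/n!`, so the fractional derivative of order `α` must be the operator
`t^n ↦ Γ(α+n+1)/n! t^n`. Three facts give the theorem.

*Existence.* For `F ∈ H(a, R)` and `r > R` the function `F(t)e^{-rt}` is bounded in every smaller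
region (`MemH.exists_bound`): its integrability along `γ(A)` bounds a primitive on `γ(A)`, and a
Phragmén–Lindelöf argument carries the bound inside. Hence `H(a, R)` is the space `HasType a R` of
functions of exponential type at most `R` in `𝔇(a)`, which is visibly stable under simple
operators. For a natural number `m > Re α`, Euler's fractional integral
`E F(t) = Γ(m-α)⁻¹ ∫_0^1 s^α (1-s)^{m-α-1} F(ts) ds` satisfies `𝓛_m E F = 𝓛_α F`, since the
Laplace transform takes convolutions to products (`HasType.laplace_eulerOp`), and integration by
parts gives `𝓛_j (j + 1 + t d/dt) F = 𝓛_{j+1} F` (`HasType.laplace_thetaOp`). So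
`G = (1 + t d/dt) ⋯ (m + t d/dt) E F` lies in `H(a, R)` and has the transform `𝓛_α F`
(`HasType.exists_fracDeriv`).

*Uniqueness.* By Fourier inversion on a vertical line and the identity theorem, elements of `H` are
determined by their transforms (`HasType.eqOn_of_laplace_eq`), so `fracDeriv α F = G` on `𝔇(a)`.

*The series.* The function `Γ(α+k+1)/k! z^k ₂F₁(α+k+1, 1; k+1; z)` is `Γ(α+1)(1-z)^{-α-1}` minus its
Taylor polynomial of degree `k - 1` (`mult_mul_gauss2F1`). This continues the hypergeometric series
to the cut plane and shows that it grows at most like `2^k` where `(1-z)^{-α-1}` is bounded, which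
makes the series of the theorem converge locally uniformly in `𝔇(A)`. Near `0` the kernels may be
expanded in powers of `t/ξ`. The integrals that result are the Taylor coefficients of
`F(t)e^{-rt}`, after deformation of `γ(A)` to a circle (`hasTaylor_contourIntegral`), and
multiplication by `e^{rt}` restores the coefficients of `F`. So the sum has the Taylor coefficients
`Γ(α+n+1)/n! F_n` of `G`, and equals `G` in all of `𝔇(A)` by the identity theorem.
-/

noncomputable section

namespace FracCalc

open MeasureTheory Set Complex Filter Topology

/-! ### Geometry of the region -/

lemma region_eq_thickening (a : ℝ) :
    region a = Metric.thickening a ((fun x : ℝ => (x : ℂ)) '' Ioi 0) := by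
  ext t
  rw [Metric.mem_thickening_iff_infDist_lt (Set.Nonempty.image _ ⟨1, by simp⟩)]
  rfl

lemma isOpen_region (a : ℝ) : IsOpen (region a) := by
  rw [region_eq_thickening]; exact Metric.isOpen_thickening

lemma convex_region (a : ℝ) : Convex ℝ (region a) := by
  rw [region_eq_thickening]
  exact ((convex_Ioi (0 : ℝ)).linear_image ofRealCLM.toLinearMap).thickening a

lemma region_mono {a b : ℝ} (h : a ≤ b) : region a ⊆ region b :=
  fun _ ht => lt_of_lt_of_le ht h

lemma infDist_ray_of_nonneg {t : ℂ} (ht : 0 ≤ t.re) :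
    Metric.infDist t ((fun x : ℝ => (x : ℂ)) '' Ioi 0) = |t.im| := by
  apply le_antisymm
  · refine le_of_forall_pos_le_add fun ε hε => ?_
    refine (Metric.infDist_le_dist_of_mem (mem_image_of_mem _
      (show t.re + ε ∈ Ioi (0 : ℝ) by simp; linarith))).trans ?_
    rw [dist_eq]
    refine (norm_le_abs_re_add_abs_im _).trans ?_
    simp [abs_of_pos hε, add_comm]
  · refine (Metric.le_infDist (Set.Nonempty.image _ ⟨1, by simp⟩)).2 ?_
    rintro _ ⟨x, _, rfl⟩
    rw [dist_eq]
    simpa using abs_im_le_norm (t - x)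

lemma infDist_ray_of_nonpos {t : ℂ} (ht : t.re ≤ 0) :
    Metric.infDist t ((fun x : ℝ => (x : ℂ)) '' Ioi 0) = ‖t‖ := by
  apply le_antisymm
  · refine le_of_forall_pos_le_add fun ε hε => ?_
    refine (Metric.infDist_le_dist_of_mem (mem_image_of_mem _
      (show ε ∈ Ioi (0 : ℝ) from hε))).trans ?_
    rw [dist_eq]
    refine (norm_sub_le _ _).trans ?_
    simp [abs_of_pos hε]
  · refine (Metric.le_infDist (Set.Nonempty.image _ ⟨1, by simp⟩)).2 ?_
    rintro _ ⟨x, hx, rfl⟩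
    have hx : 0 < x := hx
    rw [dist_eq, ← abs_of_nonneg (norm_nonneg t), ← abs_of_nonneg (norm_nonneg (t - x)),
      ← sq_le_sq, ← normSq_eq_norm_sq, ← normSq_eq_norm_sq, normSq_apply, normSq_apply]
    simp only [sub_re, ofReal_re, sub_im, ofReal_im, sub_zero]
    nlinarith

lemma ofReal_mem_region {a x : ℝ} (ha : 0 < a) (hx : 0 ≤ x) : (x : ℂ) ∈ region a := by
  change Metric.infDist _ _ < a
  rw [infDist_ray_of_nonneg (by simpa)]; simpa

lemma zero_mem_region {a : ℝ} (ha : 0 < a) : (0 : ℂ) ∈ region a := by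
  simpa using ofReal_mem_region ha le_rfl

lemma infDist_ray_le_norm (t : ℂ) :
    Metric.infDist t ((fun x : ℝ => (x : ℂ)) '' Ioi 0) ≤ ‖t‖ := by
  rcases le_total 0 t.re with h | h
  · rw [infDist_ray_of_nonneg h]; exact abs_im_le_norm t
  · rw [infDist_ray_of_nonpos h]

lemma ball_subset_region (a : ℝ) : Metric.ball (0 : ℂ) a ⊆ region a := fun t ht =>
  (infDist_ray_le_norm t).trans_lt (by simpa using ht)

lemma closedBall_subset_region {A a δ : ℝ} (h : A + δ ≤ a) {t : ℂ} (ht : t ∈ region A) :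
    Metric.closedBall t δ ⊆ region a := by
  intro s hs
  have h1 := Metric.infDist_le_infDist_add_dist (s := ((fun x : ℝ => (x : ℂ)) '' Ioi 0))
    (x := s) (y := t)
  have h2 : Metric.infDist t ((fun x : ℝ => (x : ℂ)) '' Ioi 0) < A := ht
  have h3 : dist s t ≤ δ := hs
  change Metric.infDist _ _ < _
  linarith

lemma smul_mem_region {a : ℝ} {t : ℂ} (ht : t ∈ region a) {s : ℝ} (h0 : 0 ≤ s) (h1 : s ≤ 1) :
    t * s ∈ region a := by
  have ha : 0 < a := lt_of_le_of_lt Metric.infDist_nonneg ht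
  have := (convex_region a).starConvex (zero_mem_region ha) ht (sub_nonneg.2 h1) h0 (by ring)
  simpa [mul_comm] using this

/-- The set `γ(A)` of all points at distance `A` from the half-line `(0, +∞)`. -/
def bdry (A : ℝ) : Set ℂ :=
  {t : ℂ | Metric.infDist t ((fun x : ℝ => (x : ℂ)) '' Ioi 0) = A}

lemma upper_mem_bdry {A x : ℝ} (hA : 0 ≤ A) (hx : 0 ≤ x) : (x + A * I : ℂ) ∈ bdry A := by
  change _ = _
  rw [infDist_ray_of_nonneg (by simpa)]; simpa

lemma lower_mem_bdry {A x : ℝ} (hA : 0 ≤ A) (hx : 0 ≤ x) : (x - A * I : ℂ) ∈ bdry A := by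
  change _ = _
  rw [infDist_ray_of_nonneg (by simpa)]; simpa

lemma arc_mem_bdry {A θ : ℝ} (hA : 0 ≤ A) (hθ : θ ∈ Icc (Real.pi / 2) (3 * Real.pi / 2)) :
    (A * exp (θ * I) : ℂ) ∈ bdry A := by
  change _ = _
  rw [infDist_ray_of_nonpos]
  · simp [norm_exp_ofReal_mul_I, abs_of_nonneg hA]
  · have : Real.cos θ ≤ 0 := Real.cos_nonpos_of_pi_div_two_le_of_le hθ.1 (by linarith [hθ.2])
    simpa [exp_ofReal_mul_I_re] using mul_nonpos_of_nonneg_of_nonpos hA this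

lemma bdry_subset_region {A a : ℝ} (h : A < a) : bdry A ⊆ region a := fun t ht => by
  change Metric.infDist _ _ = _ at ht
  change Metric.infDist _ _ < _
  rwa [ht]

/-- Every point of `γ(A)` lies on one of the two rays or on the half circle. -/
lemma exists_param_of_mem_bdry {A : ℝ} {t : ℂ} (ht : t ∈ bdry A) :
    (∃ x : ℝ, 0 ≤ x ∧ t = x + A * I) ∨ (∃ x : ℝ, 0 ≤ x ∧ t = x - A * I) ∨ ‖t‖ = A := by
  change Metric.infDist _ _ = _ at ht
  rcases le_total 0 t.re with h | h
  · rw [infDist_ray_of_nonneg h] at ht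
    rcases abs_choice t.im with h' | h'
    · refine Or.inl ⟨t.re, h, ?_⟩
      rw [← ht, h', re_add_im]
    · refine Or.inr (Or.inl ⟨t.re, h, ?_⟩)
      rw [← ht, h']
      push_cast
      rw [neg_mul, sub_neg_eq_add, re_add_im]
  · rw [infDist_ray_of_nonpos h] at ht
    exact Or.inr (Or.inr ht)

lemma frontier_region_subset (A : ℝ) : frontier (region A) ⊆ bdry A :=
  frontier_lt_subset_eq (Metric.continuous_infDist_pt _) continuous_const

lemma le_norm_of_mem_bdry {A : ℝ} {ξ : ℂ} (hξ : ξ ∈ bdry A) : A ≤ ‖ξ‖ := by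
  change Metric.infDist _ _ = _ at hξ
  rw [← hξ]; exact infDist_ray_le_norm ξ

lemma ne_zero_of_mem_bdry {A : ℝ} (hA : 0 < A) {ξ : ℂ} (hξ : ξ ∈ bdry A) : ξ ≠ 0 :=
  norm_pos_iff.1 (hA.trans_le (le_norm_of_mem_bdry hξ))

lemma sub_le_norm_sub_of_mem_bdry {A A' : ℝ} {ξ t : ℂ} (hξ : ξ ∈ bdry A) (ht : t ∈ region A') :
    A - A' ≤ ‖ξ - t‖ := by
  change Metric.infDist _ _ = _ at hξ
  have h1 := Metric.infDist_le_infDist_add_dist (s := ((fun x : ℝ => (x : ℂ)) '' Ioi 0))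
    (x := ξ) (y := t)
  have h2 : Metric.infDist t ((fun x : ℝ => (x : ℂ)) '' Ioi 0) < A' := ht
  rw [dist_eq] at h1
  linarith

/-- The quotient `t / ξ` avoids the cut because the region is star-shaped about `0`. -/
lemma div_mem_cutPlane {A : ℝ} (hA : 0 < A) {ξ t : ℂ} (hξ : ξ ∈ bdry A) (ht : t ∈ region A) :
    t / ξ ∈ cutPlane := by
  rintro ⟨h1, h2⟩
  have hξ0 := ne_zero_of_mem_bdry hA hξ
  set s := (t / ξ).re with hs
  have hts : t = s * ξ := by
    have : t / ξ = s := Complex.ext (by simp [hs]) (by simp [h2])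
    rw [← this, div_mul_cancel₀ _ hξ0]
  have ht : Metric.infDist _ _ < A := ht
  change Metric.infDist _ _ = _ at hξ
  have hs0 : 0 ≤ s := by linarith
  rcases le_total 0 ξ.re with h | h
  · rw [infDist_ray_of_nonneg (by rw [hts]; simp; positivity), hts] at ht
    rw [infDist_ray_of_nonneg h] at hξ
    rw [im_ofReal_mul, abs_mul, hξ, abs_of_nonneg hs0] at ht
    nlinarith
  · rw [infDist_ray_of_nonpos (by rw [hts]; simp; exact mul_nonpos_of_nonneg_of_nonpos hs0 h),
      hts] at ht
    rw [infDist_ray_of_nonpos h] at hξ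
    rw [norm_mul, hξ, norm_real, Real.norm_of_nonneg hs0] at ht
    nlinarith

/-! ### Holomorphic dependence of integrals on a parameter, and primitives -/

/-- An integral depending on a parameter is holomorphic if the integrand is holomorphic in the
parameter and locally dominated by an integrable function; by Cauchy's estimate no domination of
the derivative has to be assumed. -/
lemma hasDerivAt_integral_of_holomorphic {X : Type*} [MeasurableSpace X] {μ : Measure X}
    {U : Set ℂ} (hU : IsOpen U) {f : ℂ → X → ℂ}
    (hmeas : ∀ t ∈ U, AEStronglyMeasurable (f t) μ)
    (hdiff : ∀ᵐ x ∂μ, DifferentiableOn ℂ (fun t => f t x) U)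
    {t₀ : ℂ} (ht₀ : t₀ ∈ U) {δ : ℝ} (hδ : 0 < δ) {g : X → ℝ} (hg : Integrable g μ)
    (hbound : ∀ᵐ x ∂μ, ∀ t ∈ U ∩ Metric.ball t₀ δ, ‖f t x‖ ≤ g x) :
    HasDerivAt (fun t => ∫ x, f t x ∂μ) (∫ x, deriv (fun t => f t x) t₀ ∂μ) t₀ := by
  obtain ⟨ε, hε, hεU⟩ := Metric.isOpen_iff.1 (hU.inter Metric.isOpen_ball) t₀
    ⟨ht₀, Metric.mem_ball_self hδ⟩
  have hsub : ∀ t ∈ Metric.ball t₀ (ε / 2), Metric.closedBall t (ε / 3) ⊆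
      U ∩ Metric.ball t₀ δ := by
    intro t ht
    refine Subset.trans ?_ hεU
    refine Metric.closedBall_subset_ball' ?_
    have : dist t t₀ < ε / 2 := ht
    linarith
  have hb : Metric.ball t₀ (ε / 2) ∈ 𝓝 t₀ := Metric.ball_mem_nhds _ (by linarith)
  refine (hasDerivAt_integral_of_dominated_loc_of_deriv_le
    (F' := fun t x => deriv (fun t => f t x) t)
    (bound := fun x => g x / (ε / 3)) hb ?_ ?_ ?_ ?_ ?_ ?_).2
  · filter_upwards [hU.mem_nhds ht₀] with t ht using hmeas t ht
  · refine hg.mono' (hmeas _ ht₀) ?_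
    filter_upwards [hbound] with x hx using hx t₀ ⟨ht₀, Metric.mem_ball_self hδ⟩
  · -- the derivative is the pointwise limit of measurable difference quotients
    have hseq : Tendsto (fun n : ℕ => t₀ + (((ε / 4) / ((n : ℝ) + 1) : ℝ) : ℂ)) atTop
        (𝓝[≠] t₀) := by
      refine tendsto_nhdsWithin_iff.2 ⟨?_, ?_⟩
      · have h0 : Tendsto (fun n : ℕ => (ε / 4) / ((n : ℝ) + 1)) atTop (𝓝 0) :=
          tendsto_const_nhds.div_atTop
            (tendsto_atTop_add_const_right _ _ tendsto_natCast_atTop_atTop)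
        have := (continuous_ofReal.tendsto 0).comp h0
        simpa using tendsto_const_nhds (x := t₀) |>.add this
      · refine Eventually.of_forall fun n => ?_
        have : (0 : ℝ) < (ε / 4) / ((n : ℝ) + 1) := by positivity
        simp only [mem_compl_iff, mem_singleton_iff, add_eq_left, ofReal_eq_zero]
        exact this.ne'
    refine aestronglyMeasurable_of_tendsto_ae atTop
      (f := fun (n : ℕ) x =>
        slope (fun t => f t x) t₀ (t₀ + (((ε / 4) / ((n : ℝ) + 1) : ℝ) : ℂ))) ?_ ?_
    · intro n
      have hmem : t₀ + (((ε / 4) / ((n : ℝ) + 1) : ℝ) : ℂ) ∈ U := by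
        refine (hεU ?_).1
        have hp : (0 : ℝ) < (ε / 4) / ((n : ℝ) + 1) := by positivity
        have : (ε / 4) / ((n : ℝ) + 1) ≤ ε / 4 :=
          div_le_self (by linarith) (by linarith [n.cast_nonneg (α := ℝ)])
        rw [Metric.mem_ball, dist_eq, add_sub_cancel_left, norm_real, Real.norm_of_nonneg hp.le]
        linarith
      refine (((hmeas _ hmem).sub (hmeas _ ht₀)).const_mul
        (t₀ + (((ε / 4) / ((n : ℝ) + 1) : ℝ) : ℂ) - t₀)⁻¹).congr (Eventually.of_forall fun x => ?_)
      simp only [slope_def_field, Pi.sub_apply]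
      rw [div_eq_inv_mul (_ - _)]
    · filter_upwards [hdiff] with x hx
      have hd := ((hx t₀ ht₀).differentiableAt (hU.mem_nhds ht₀)).hasDerivAt
      exact (hasDerivAt_iff_tendsto_slope.1 hd).comp hseq
  · filter_upwards [hbound, hdiff] with x hx hd t ht
    refine norm_deriv_le_of_forall_mem_sphere_norm_le (by linarith) ?_ ?_
    · refine DifferentiableOn.diffContOnCl_ball (U := U) hd ((hsub t ht).trans inter_subset_left)
    · intro z hz
      exact hx z (hsub t ht (Metric.sphere_subset_closedBall hz))
  · exact hg.div_const _
  · filter_upwards [hdiff] with x hd t ht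
    have : t ∈ U := (hsub t ht (Metric.mem_closedBall_self (by linarith))).1
    exact ((hd t this).differentiableAt (hU.mem_nhds this)).hasDerivAt

/-- A holomorphic function on an open set that is star-shaped about one of its points has a
primitive there. -/
lemma exists_primitive_of_starConvex {U : Set ℂ} (hU : IsOpen U) {z₀ : ℂ}
    (hs : StarConvex ℝ z₀ U) {g : ℂ → ℂ} (hg : DifferentiableOn ℂ g U) :
    ∃ P : ℂ → ℂ, ∀ z ∈ U, HasDerivAt P (g z) z := by
  have hmem : ∀ z ∈ U, ∀ s ∈ Icc (0 : ℝ) 1, z₀ + s * (z - z₀) ∈ U := by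
    intro z hz s hs'
    have := hs hz (sub_nonneg.2 hs'.2) hs'.1 (by ring)
    convert this using 1
    simp only [real_smul, ofReal_sub, ofReal_one]; ring
  have hline : ∀ z : ℂ, Continuous fun s : ℝ => z₀ + s * (z - z₀) := fun z => by fun_prop
  have hcont : ∀ z ∈ U, ContinuousOn (fun s : ℝ => g (z₀ + s * (z - z₀))) (Icc 0 1) := fun z hz =>
    hg.continuousOn.comp (hline z).continuousOn fun s hs' => hmem z hz s hs'
  have hgd : ∀ z ∈ U, HasDerivAt g (deriv g z) z := fun z hz =>
    ((hg z hz).differentiableAt (hU.mem_nhds hz)).hasDerivAt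
  have hg' : DifferentiableOn ℂ (deriv g) U := hg.deriv hU
  refine ⟨fun z => (z - z₀) * ∫ s in Icc (0 : ℝ) 1, g (z₀ + s * (z - z₀)), fun z hz => ?_⟩
  obtain ⟨δ, hδ, hδU⟩ := Metric.isOpen_iff.1 hU z hz
  -- the segments from `z₀` to the points of a small closed ball fill a compact set
  have hK : IsCompact ((fun p : ℂ × ℝ => z₀ + p.2 * (p.1 - z₀)) ''
      (Metric.closedBall z (δ / 2) ×ˢ Icc (0 : ℝ) 1)) :=
    ((isCompact_closedBall _ _).prod isCompact_Icc).image (by fun_prop)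
  have hcb : Metric.closedBall z (δ / 2) ⊆ U :=
    (Metric.closedBall_subset_ball (by linarith)).trans hδU
  have hKU : ((fun p : ℂ × ℝ => z₀ + p.2 * (p.1 - z₀)) ''
      (Metric.closedBall z (δ / 2) ×ˢ Icc (0 : ℝ) 1)) ⊆ U := by
    rintro _ ⟨⟨w, s⟩, ⟨hw, hs'⟩, rfl⟩
    exact hmem w (hcb hw) s hs'
  obtain ⟨C, hC⟩ := hK.exists_bound_of_continuousOn (hg.continuousOn.mono hKU)
  have key := hasDerivAt_integral_of_holomorphic (μ := volume.restrict (Icc (0 : ℝ) 1)) hU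
    (f := fun z s => g (z₀ + s * (z - z₀)))
    (fun w hw => (hcont w hw).aestronglyMeasurable measurableSet_Icc)
    ((ae_restrict_iff' measurableSet_Icc).2 (Eventually.of_forall fun s hs' =>
      hg.comp (by fun_prop) fun w hw => hmem w hw s hs'))
    hz (half_pos hδ) (g := fun _ => C) (integrable_const C)
    ((ae_restrict_iff' measurableSet_Icc).2 (Eventually.of_forall fun s hs' w hw =>
      hC _ ⟨(w, s), ⟨Metric.ball_subset_closedBall hw.2, hs'⟩, rfl⟩))
  refine (((hasDerivAt_id z).sub_const z₀).mul key).congr_deriv ?_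
  have hder : ∀ s ∈ Icc (0 : ℝ) 1, deriv (fun w => g (z₀ + s * (w - z₀))) z =
      s * deriv g (z₀ + s * (z - z₀)) := by
    intro s hs'
    have h1 : HasDerivAt (fun w : ℂ => z₀ + s * (w - z₀)) (s * 1) z :=
      (((hasDerivAt_id z).sub_const z₀).const_mul (s : ℂ)).const_add z₀
    have := ((hgd _ (hmem z hz s hs')).comp z h1).deriv
    rw [mul_one, mul_comm] at this
    exact this
  rw [setIntegral_congr_fun measurableSet_Icc hder]
  have hint1 : IntegrableOn (fun s : ℝ => g (z₀ + s * (z - z₀))) (Icc 0 1) :=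
    (hcont z hz).integrableOn_compact isCompact_Icc
  have hint2 : IntegrableOn (fun s : ℝ => (z - z₀) * (s * deriv g (z₀ + s * (z - z₀))))
      (Icc 0 1) := by
    refine ContinuousOn.integrableOn_compact isCompact_Icc ?_
    refine continuousOn_const.mul (continuous_ofReal.continuousOn.mul ?_)
    exact hg'.continuousOn.comp (hline z).continuousOn fun s hs' => hmem z hz s hs'
  simp only [id, one_mul]
  rw [← integral_const_mul, ← integral_add hint1 hint2, integral_Icc_eq_integral_Ioc,
    ← intervalIntegral.integral_of_le zero_le_one]
  have hF : ∀ s ∈ uIcc (0 : ℝ) 1, HasDerivAt (fun s : ℝ => (s : ℂ) * g (z₀ + s * (z - z₀)))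
      (g (z₀ + s * (z - z₀)) + (z - z₀) * (s * deriv g (z₀ + s * (z - z₀)))) s := by
    intro s hs'
    rw [uIcc_of_le zero_le_one] at hs'
    have h1 : HasDerivAt (fun s : ℝ => z₀ + (s : ℂ) * (z - z₀)) (1 * (z - z₀)) s :=
      ((ofRealCLM.hasDerivAt (x := s)).mul_const (z - z₀)).const_add z₀
    have h2 := (hgd _ (hmem z hz s hs')).comp s h1
    refine ((ofRealCLM.hasDerivAt (x := s)).mul h2).congr_deriv ?_
    simp; ring
  rw [intervalIntegral.integral_eq_sub_of_hasDerivAt hF]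
  · simp
  · rw [intervalIntegrable_iff_integrableOn_Icc_of_le zero_le_one]
    exact hint1.add hint2

/-! ### Functions of bounded exponential type and the spaces `H(a, R)` -/

/-- Functions analytic in `𝔇(a)` and of exponential type at most `R` there: `F = O(e^{r|t|})` on
`𝔇(A)` for all `r > R` and `A < a`. For `R ≥ 0` these are exactly the elements of `H(a, R)`, see
`HasType.memH` and `MemH.hasType`. -/
structure HasType (a R : ℝ) (F : ℂ → ℂ) : Prop where
  diff : DifferentiableOn ℂ F (region a)
  bound : ∀ r : ℝ, R < r → ∀ A : ℝ, 0 < A → A < a →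
    ∃ C : ℝ, ∀ t ∈ region A, ‖F t‖ ≤ C * Real.exp (r * ‖t‖)

lemma integrableOn_ray_of_bound {g : ℝ → ℂ} (hc : ContinuousOn g (Ioi 0)) {C δ : ℝ} (hδ : 0 < δ)
    (hb : ∀ x ∈ Ioi (0 : ℝ), ‖g x‖ ≤ C * Real.exp (-δ * x)) : IntegrableOn g (Ioi 0) :=
  ((exp_neg_integrableOn_Ioi 0 hδ).const_mul C).mono' (hc.aestronglyMeasurable measurableSet_Ioi)
    ((ae_restrict_iff' measurableSet_Ioi).2 (Eventually.of_forall hb))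

lemma le_norm_upper (A : ℝ) {x : ℝ} (hx : 0 < x) : x ≤ ‖(x + A * I : ℂ)‖ := by
  simpa [abs_of_pos hx] using abs_re_le_norm (x + A * I : ℂ)

lemma le_norm_lower (A : ℝ) {x : ℝ} (hx : 0 < x) : x ≤ ‖(x - A * I : ℂ)‖ := by
  simpa [abs_of_pos hx] using abs_re_le_norm (x - A * I : ℂ)

lemma absConvergent_of_bound {A C δ : ℝ} (hA : 0 ≤ A) (hδ : 0 < δ) {g : ℂ → ℂ}
    (hg : ContinuousOn g (bdry A)) (hb : ∀ ξ ∈ bdry A, ‖g ξ‖ ≤ C * Real.exp (-δ * ‖ξ‖)) :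
    AbsConvergent A g := by
  have hC : 0 ≤ C := by
    have h := (norm_nonneg _).trans (hb _ (upper_mem_bdry hA le_rfl))
    exact nonneg_of_mul_nonneg_left h (Real.exp_pos _)
  refine ⟨?_, ?_, ?_⟩
  · refine integrableOn_ray_of_bound (hg.comp (by fun_prop) fun x hx =>
      upper_mem_bdry hA (le_of_lt hx)) hδ (C := C) fun x hx => ?_
    refine (hb _ (upper_mem_bdry hA (le_of_lt hx))).trans ?_
    have := le_norm_upper A hx
    gcongr C * Real.exp ?_
    nlinarith
  · exact ContinuousOn.integrableOn_compact isCompact_Icc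
      (hg.comp (by fun_prop) fun θ hθ => arc_mem_bdry hA hθ)
  · refine integrableOn_ray_of_bound (hg.comp (by fun_prop) fun x hx =>
      lower_mem_bdry hA (le_of_lt hx)) hδ (C := C) fun x hx => ?_
    refine (hb _ (lower_mem_bdry hA (le_of_lt hx))).trans ?_
    have := le_norm_lower A hx
    gcongr C * Real.exp ?_
    nlinarith

lemma HasType.memH {a R : ℝ} {F : ℂ → ℂ} (hF : HasType a R F) : MemH a R F where
  analytic := hF.diff.analyticOnNhd (isOpen_region a)
  growth A hA hAa := by
    obtain ⟨C, hC⟩ := hF.bound (R + 1) (by linarith) A hA hAa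
    exact ⟨C, R + 1, hC⟩
  norm_finite r hr A hA hAa := by
    obtain ⟨C, hC⟩ := hF.bound ((R + r) / 2) (by linarith) ((A + a) / 2) (by linarith)
      (by linarith)
    refine absConvergent_of_bound hA.le (δ := (r - R) / 2) (C := C) (by linarith) ?_ ?_
    · exact ContinuousOn.mul (by fun_prop) (hF.diff.continuousOn.mono (bdry_subset_region hAa))
    · intro ξ hξ
      have h := hC ξ (bdry_subset_region (by linarith) hξ)
      rw [norm_mul, norm_real, Real.norm_of_nonneg (Real.exp_pos _).le]
      calc Real.exp (-r * ‖ξ‖) * ‖F ξ‖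
          ≤ Real.exp (-r * ‖ξ‖) * (C * Real.exp ((R + r) / 2 * ‖ξ‖)) := by gcongr
        _ = C * (Real.exp (-r * ‖ξ‖) * Real.exp ((R + r) / 2 * ‖ξ‖)) := by ring
        _ = C * Real.exp (-((r - R) / 2) * ‖ξ‖) := by rw [← Real.exp_add]; ring_nf

lemma norm_exp_neg_mul_le {r A x : ℝ} (hr : 0 ≤ r) (hA : 0 ≤ A) (hx : 0 ≤ x) {t : ℂ}
    (ht : t = x + A * I ∨ t = x - A * I) :
    ‖exp (-r * t)‖ ≤ Real.exp (r * A) * Real.exp (-r * ‖t‖) := by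
  have hre : t.re = x := by rcases ht with rfl | rfl <;> simp
  have him : |t.im| = A := by rcases ht with rfl | rfl <;> simp [abs_of_nonneg hA]
  rw [norm_exp, ← Real.exp_add, Real.exp_le_exp]
  have h := norm_le_abs_re_add_abs_im t
  rw [hre, him, abs_of_nonneg hx] at h
  have : (-(r : ℂ) * t).re = -r * x := by
    rw [← ofReal_neg, re_ofReal_mul, hre]
  rw [this]
  nlinarith

lemma abs_im_le_of_infDist_le {A : ℝ} {t : ℂ}
    (ht : Metric.infDist t ((fun x : ℝ => (x : ℂ)) '' Ioi 0) ≤ A) : |t.im| ≤ A := by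
  rcases le_total 0 t.re with h | h
  · rwa [infDist_ray_of_nonneg h] at ht
  · rw [infDist_ray_of_nonpos h] at ht; exact (abs_im_le_norm t).trans ht

/-- Along a ray a primitive of an integrable function is bounded. -/
lemma bounded_on_ray_of_primitive {U : Set ℂ} {P h : ℂ → ℂ}
    (hP : ∀ z ∈ U, HasDerivAt P (h z) z) (hh : ContinuousOn h U) {c : ℂ}
    (hc : ∀ x : ℝ, 0 ≤ x → (x + c : ℂ) ∈ U)
    (hint : IntegrableOn (fun x : ℝ => h (x + c)) (Ioi 0)) :
    ∃ M, ∀ x : ℝ, 0 ≤ x → ‖P (x + c)‖ ≤ M := by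
  refine ⟨‖P c‖ + ∫ x in Ioi (0 : ℝ), ‖h (x + c)‖, fun x hx => ?_⟩
  have hder : ∀ s ∈ uIcc 0 x, HasDerivAt (fun s : ℝ => P (s + c)) (h (s + c)) s := by
    intro s hs
    rw [uIcc_of_le hx] at hs
    have h1 : HasDerivAt (fun s : ℝ => (s : ℂ) + c) 1 s :=
      (ofRealCLM.hasDerivAt (x := s)).add_const c
    exact ((hP _ (hc s hs.1)).comp s h1).congr_deriv (mul_one _)
  have hci : IntervalIntegrable (fun s : ℝ => h (s + c)) volume 0 x := by
    refine ContinuousOn.intervalIntegrable ?_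
    rw [uIcc_of_le hx]
    exact hh.comp (by fun_prop) fun s hs => hc s hs.1
  have h2 := intervalIntegral.integral_eq_sub_of_hasDerivAt hder hci
  simp only [ofReal_zero, zero_add] at h2
  have h3 : P (x + c) = P c + ∫ s in (0 : ℝ)..x, h (s + c) := by rw [h2]; ring
  rw [h3]
  refine (norm_add_le _ _).trans (add_le_add le_rfl ?_)
  refine (intervalIntegral.norm_integral_le_integral_norm hx).trans ?_
  rw [intervalIntegral.integral_of_le hx]
  exact setIntegral_mono_set hint.norm (Eventually.of_forall fun _ => norm_nonneg _)
    Ioc_subset_Ioi_self.eventuallyLE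

/-- A Phragmén–Lindelöf principle for `𝔇(A)`: a function of exponential growth that is bounded
on the boundary is bounded by the same constant inside. -/
lemma norm_le_of_bdry_bound {A M C σ : ℝ} {P : ℂ → ℂ}
    (hP : DiffContOnCl ℂ P (region A)) (hM : ∀ z ∈ bdry A, ‖P z‖ ≤ M) (hM0 : 0 < M)
    (hgrowth : ∀ z ∈ closure (region A), ‖P z‖ ≤ C * Real.exp (σ * ‖z‖)) {z : ℂ}
    (hz : z ∈ region A) : ‖P z‖ ≤ M := by
  have him : ∀ w ∈ closure (region A), |w.im| ≤ A := fun w hw => by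
    refine abs_im_le_of_infDist_le ?_
    exact closure_lt_subset_le (Metric.continuous_infDist_pt _) continuous_const hw
  have hA : 0 ≤ A := (abs_nonneg _).trans (him z (subset_closure hz))
  have hnorm : ∀ (ε : ℝ) (w : ℂ), ‖exp (-ε * w ^ 2)‖ =
      Real.exp (-ε * ‖w‖ ^ 2 + 2 * ε * w.im ^ 2) := by
    intro ε w
    rw [norm_exp, ← normSq_eq_norm_sq, normSq_apply]
    congr 1
    rw [← ofReal_neg, re_ofReal_mul, pow_two, mul_re]
    ring
  -- the factor `e^{-εw²}` makes the function small at infinity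
  have key : ∀ ε : ℝ, 0 < ε → ‖P z‖ * ‖exp (-ε * z ^ 2)‖ ≤ M * Real.exp (2 * ε * A ^ 2) := by
    intro ε hε
    have hexp : ∀ w ∈ closure (region A), ‖exp (-ε * w ^ 2)‖ ≤
        Real.exp (-ε * ‖w‖ ^ 2) * Real.exp (2 * ε * A ^ 2) := by
      intro w hw
      rw [hnorm, ← Real.exp_add, Real.exp_le_exp]
      have : w.im ^ 2 ≤ A ^ 2 := sq_le_sq.2 ((him w hw).trans (le_abs_self _))
      nlinarith
    have hlim : Tendsto (fun ρ : ℝ => C * Real.exp (σ * ρ + -ε * ρ ^ 2)) atTop (𝓝 0) := by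
      have h1 : Tendsto (fun ρ : ℝ => σ * ρ + -ε * ρ ^ 2) atTop atBot := by
        have h2 : Tendsto (fun ρ : ℝ => ρ * (σ + -ε * ρ)) atTop atBot :=
          tendsto_id.atTop_mul_atBot₀ (tendsto_atBot_add_const_left _ _
            (tendsto_id.const_mul_atTop_of_neg (by linarith)))
        refine h2.congr fun ρ => ?_
        ring
      simpa using (Real.tendsto_exp_atBot.comp h1).const_mul C
    obtain ⟨ρ, hρM, hρz⟩ := ((hlim.eventually_le_const hM0).and
      (eventually_gt_atTop ‖z‖)).exists
    rw [← norm_mul]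
    refine norm_le_of_forall_mem_frontier_norm_le (f := fun w => P w * exp (-ε * w ^ 2))
      (U := region A ∩ Metric.ball 0 ρ)
      (Metric.isBounded_ball.subset inter_subset_right) ?_ ?_
      (subset_closure ⟨hz, by simpa using hρz⟩)
    · exact (hP.mono inter_subset_left).smul (f := fun w => exp (-ε * w ^ 2))
        (Differentiable.diffContOnCl (by fun_prop))
    · intro w hw
      have hw' := frontier_inter_subset _ _ hw
      have hwc : w ∈ closure (region A) := closure_mono inter_subset_left hw.1
      rw [norm_mul]
      rcases hw' with ⟨h1, _⟩ | ⟨_, h2⟩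
      · calc ‖P w‖ * ‖exp (-ε * w ^ 2)‖
            ≤ M * (Real.exp (-ε * ‖w‖ ^ 2) * Real.exp (2 * ε * A ^ 2)) := by
              gcongr
              · exact hM w (frontier_region_subset A h1)
              · exact hexp w hwc
          _ ≤ M * (1 * Real.exp (2 * ε * A ^ 2)) := by
              gcongr
              rw [Real.exp_le_one_iff]
              nlinarith [sq_nonneg ‖w‖]
          _ = _ := by ring
      · have hwρ : ‖w‖ = ρ := by simpa using Metric.frontier_ball_subset_sphere h2
        calc ‖P w‖ * ‖exp (-ε * w ^ 2)‖
            ≤ (C * Real.exp (σ * ρ)) * (Real.exp (-ε * ρ ^ 2) * Real.exp (2 * ε * A ^ 2)) := by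
              have := hgrowth w hwc
              have h3 := hexp w hwc
              rw [hwρ] at this h3
              gcongr
              exact (norm_nonneg _).trans this
          _ = (C * Real.exp (σ * ρ + -ε * ρ ^ 2)) * Real.exp (2 * ε * A ^ 2) := by
              rw [Real.exp_add]; ring
          _ ≤ _ := by gcongr
  have h1 : Tendsto (fun ε : ℝ => ‖P z‖ * ‖exp (-ε * z ^ 2)‖) (𝓝[>] 0) (𝓝 ‖P z‖) := by
    have : Continuous fun ε : ℝ => ‖P z‖ * ‖exp (-ε * z ^ 2)‖ := by fun_prop
    simpa using (this.tendsto 0).mono_left nhdsWithin_le_nhds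
  have h2 : Tendsto (fun ε : ℝ => M * Real.exp (2 * ε * A ^ 2)) (𝓝[>] 0) (𝓝 M) := by
    have : Continuous fun ε : ℝ => M * Real.exp (2 * ε * A ^ 2) := by fun_prop
    simpa using (this.tendsto 0).mono_left nhdsWithin_le_nhds
  exact le_of_tendsto_of_tendsto h1 h2 (eventually_nhdsWithin_of_forall key)

/-- For `F ∈ H(a, R)` and `r > R` the function `F(t)e^{-rt}` is bounded in each smaller region.
Its integrability along `γ(A)` makes a primitive bounded on `γ(A)`, hence inside `γ(A)` by
Phragmén–Lindelöf; Cauchy's estimate then bounds the function itself. -/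
lemma MemH.exists_bound {a R : ℝ} (hR : 0 ≤ R) {F : ℂ → ℂ} (hF : MemH a R F) {r : ℝ} (hr : R < r)
    {A : ℝ} (hA : 0 < A) (hAa : A < a) :
    ∃ C, ∀ t ∈ region A, ‖F t * exp (-r * t)‖ ≤ C := by
  have hr0 : 0 ≤ r := hR.trans hr.le
  set h : ℂ → ℂ := fun t => F t * exp (-r * t) with hh
  have hFd : DifferentiableOn ℂ F (region a) := hF.analytic.differentiableOn
  have hhd : DifferentiableOn ℂ h (region a) := hFd.mul (by fun_prop)
  obtain ⟨P, hP⟩ := exists_primitive_of_starConvex (isOpen_region a)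
    ((convex_region a).starConvex (zero_mem_region (hA.trans hAa))) hhd
  set A' := (A + a) / 2 with hA'
  have hAA' : A < A' := by rw [hA']; linarith
  have hA'a : A' < a := by rw [hA']; linarith
  have hA'0 : 0 < A' := hA.trans hAA'
  have hPd : DifferentiableOn ℂ P (region a) := fun z hz =>
    (hP z hz).differentiableAt.differentiableWithinAt
  have hclos : closure (region A') ⊆ region ((A' + a) / 2) := by
    intro w hw
    have : Metric.infDist w ((fun x : ℝ => (x : ℂ)) '' Ioi 0) ≤ A' :=
      closure_lt_subset_le (Metric.continuous_infDist_pt _) continuous_const hw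
    change Metric.infDist _ _ < _
    linarith
  have hsub : region ((A' + a) / 2) ⊆ region a := region_mono (by linarith)
  -- the primitive is bounded on the boundary
  obtain ⟨hi1, -, hi3⟩ := hF.norm_finite r hr A' hA'0 hA'a
  have hray : ∀ c : ℂ, (c = A' * I ∨ c = -(A' * I)) →
      IntegrableOn (fun x : ℝ => (Real.exp (-r * ‖(x + c : ℂ)‖) : ℂ) * F (x + c)) (Ioi 0) →
      ∃ M, ∀ x : ℝ, 0 ≤ x → ‖P (x + c)‖ ≤ M := by
    intro c hc hint
    have hmem : ∀ x : ℝ, 0 ≤ x → (x + c : ℂ) ∈ region a := by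
      intro x hx
      rcases hc with rfl | rfl
      · exact bdry_subset_region hA'a (upper_mem_bdry hA'0.le hx)
      · rw [← sub_eq_add_neg]
        exact bdry_subset_region hA'a (lower_mem_bdry hA'0.le hx)
    refine bounded_on_ray_of_primitive hP hhd.continuousOn hmem ?_
    refine (hint.norm.const_mul (Real.exp (r * A'))).mono' ?_ ?_
    · exact (hhd.continuousOn.comp (by fun_prop) fun x hx =>
        hmem x (le_of_lt hx)).aestronglyMeasurable measurableSet_Ioi
    · refine (ae_restrict_iff' measurableSet_Ioi).2 (Eventually.of_forall fun x hx => ?_)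
      have h1 := norm_exp_neg_mul_le (r := r) (A := A') (x := x) (t := x + c) hr0 hA'0.le
        (le_of_lt hx) (by
          rcases hc with rfl | rfl
          · exact Or.inl rfl
          · exact Or.inr (sub_eq_add_neg _ _).symm)
      rw [hh, norm_mul, norm_mul, norm_real, Real.norm_of_nonneg (Real.exp_pos _).le]
      calc ‖F (x + c)‖ * ‖exp (-r * (x + c))‖
          ≤ ‖F (x + c)‖ * (Real.exp (r * A') * Real.exp (-r * ‖(x + c : ℂ)‖)) := by gcongr
        _ = _ := by ring
  obtain ⟨M1, hM1⟩ := hray (A' * I) (Or.inl rfl) hi1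
  obtain ⟨M2, hM2⟩ := hray (-(A' * I)) (Or.inr rfl) (by simpa only [sub_eq_add_neg] using hi3)
  obtain ⟨M3, hM3⟩ := (isCompact_sphere (0 : ℂ) A').exists_bound_of_continuousOn
    (hPd.continuousOn.mono fun w hw => by
      refine (infDist_ray_le_norm w).trans_lt ?_
      rwa [mem_sphere_zero_iff_norm.1 hw])
  set M := max (max M1 M2) (max M3 1) with hM
  have hM0 : 0 < M := zero_lt_one.trans_le ((le_max_right _ _).trans (le_max_right _ _))
  have hbd : ∀ z ∈ bdry A', ‖P z‖ ≤ M := by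
    intro z hz
    rcases exists_param_of_mem_bdry hz with ⟨x, hx, rfl⟩ | ⟨x, hx, rfl⟩ | hn
    · exact (hM1 x hx).trans ((le_max_left _ _).trans (le_max_left _ _))
    · rw [sub_eq_add_neg]
      exact (hM2 x hx).trans ((le_max_right _ _).trans (le_max_left _ _))
    · exact (hM3 z (mem_sphere_zero_iff_norm.2 hn)).trans
        ((le_max_left _ _).trans (le_max_right _ _))
  -- the primitive has exponential growth
  obtain ⟨C, σ, hC⟩ := hF.growth ((A' + a) / 2) (by linarith) (by linarith)
  have hC0 : 0 ≤ C := nonneg_of_mul_nonneg_left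
    ((norm_nonneg _).trans (hC 0 (zero_mem_region (by linarith)))) (Real.exp_pos _)
  have hhb : ∀ w ∈ region ((A' + a) / 2), ‖h w‖ ≤ C * Real.exp ((|σ| + r) * ‖w‖) := by
    intro w hw
    have h1 : ‖exp (-r * w)‖ ≤ Real.exp (r * ‖w‖) := by
      rw [norm_exp, Real.exp_le_exp]
      refine (re_le_norm _).trans ?_
      rw [norm_mul, norm_neg, norm_real, Real.norm_of_nonneg hr0]
    calc ‖h w‖ ≤ (C * Real.exp (|σ| * ‖w‖)) * Real.exp (r * ‖w‖) := by
          rw [hh, norm_mul]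
          gcongr
          exact (hC w hw).trans (by gcongr; exact le_abs_self σ)
      _ = C * Real.exp ((|σ| + r) * ‖w‖) := by rw [mul_assoc, ← Real.exp_add]; ring_nf
  have hσ0 : 0 ≤ |σ| + r := by positivity
  have hgrow : ∀ z ∈ closure (region A'),
      ‖P z‖ ≤ (‖P 0‖ + C) * Real.exp ((|σ| + r + 1) * ‖z‖) := by
    intro z hz
    have hzr := hclos hz
    have h1 : ‖P z - P 0‖ ≤ C * Real.exp ((|σ| + r) * ‖z‖) * ‖z - 0‖ := by
      refine (convex_segment (0 : ℂ) z).norm_image_sub_le_of_norm_hasDerivWithin_le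
        (f' := h) ?_ ?_ (left_mem_segment ℝ 0 z) (right_mem_segment ℝ 0 z)
      · intro w hw
        have := (convex_region _).segment_subset (zero_mem_region (by linarith)) hzr hw
        exact (hP w (hsub this)).hasDerivWithinAt
      · intro w hw
        have := (convex_region _).segment_subset (zero_mem_region (by linarith)) hzr hw
        refine (hhb w this).trans ?_
        gcongr
        have := (convex_closedBall (0 : ℂ) ‖z‖).segment_subset (by simp) (by simp) hw
        simpa using this
    have h2 : ‖z‖ ≤ Real.exp ‖z‖ := by linarith [Real.add_one_le_exp ‖z‖]
    have h3 : 1 ≤ Real.exp ((|σ| + r + 1) * ‖z‖) := Real.one_le_exp (by positivity)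
    have h4 : ‖P z‖ ≤ ‖P 0‖ + ‖P z - P 0‖ := by
      simpa using norm_add_le (P 0) (P z - P 0)
    rw [sub_zero] at h1
    calc ‖P z‖ ≤ ‖P 0‖ * 1 + C * Real.exp ((|σ| + r) * ‖z‖) * ‖z‖ := by linarith
      _ ≤ ‖P 0‖ * Real.exp ((|σ| + r + 1) * ‖z‖) +
          C * Real.exp ((|σ| + r) * ‖z‖) * Real.exp ‖z‖ := by gcongr
      _ = _ := by
          rw [mul_assoc C, ← Real.exp_add, show (|σ| + r) * ‖z‖ + ‖z‖ = (|σ| + r + 1) * ‖z‖ by ring]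
          ring
  have hPM : ∀ z ∈ region A', ‖P z‖ ≤ M := fun z hz =>
    norm_le_of_bdry_bound
      (DifferentiableOn.diffContOnCl (hPd.mono (hclos.trans hsub))) hbd hM0 hgrow hz
  refine ⟨M / ((A' - A) / 2), fun t ht => ?_⟩
  have hsubb : Metric.closedBall t ((A' - A) / 2) ⊆ region A' :=
    closedBall_subset_region (by linarith) ht
  have htm : t ∈ region a := region_mono hAa.le ht
  rw [show F t * exp (-r * t) = deriv P t from (hP t htm).deriv.symm]
  refine norm_deriv_le_of_forall_mem_sphere_norm_le (by linarith) ?_ ?_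
  · exact DifferentiableOn.diffContOnCl_ball (U := region a) hPd
      (hsubb.trans (region_mono hA'a.le))
  · exact fun z hz => hPM z (hsubb (Metric.sphere_subset_closedBall hz))

lemma MemH.hasType {a R : ℝ} (hR : 0 ≤ R) {F : ℂ → ℂ} (hF : MemH a R F) : HasType a R F where
  diff := hF.analytic.differentiableOn
  bound r hr A hA hAa := by
    obtain ⟨C, hC⟩ := hF.exists_bound hR hr hA hAa
    refine ⟨C, fun t ht => ?_⟩
    have hr0 : 0 ≤ r := hR.trans hr.le
    have hC0 : 0 ≤ C := (norm_nonneg _).trans (hC t ht)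
    have h1 : F t = F t * exp (-r * t) * exp (r * t) := by
      rw [mul_assoc, ← Complex.exp_add]; simp
    rw [h1, norm_mul]
    gcongr
    · exact hC t ht
    · rw [norm_exp, Real.exp_le_exp]
      refine (re_le_norm _).trans ?_
      rw [norm_mul, norm_real, Real.norm_of_nonneg hr0]

/-! ### Laplace integrals -/

lemma norm_exp_neg_mul_ofReal (ζ : ℂ) (t : ℝ) : ‖exp (-ζ * t)‖ = Real.exp (-ζ.re * t) := by
  rw [norm_exp, re_mul_ofReal, neg_re]

/-- The integrals `∫_0^∞ e^{-ζt} t^s F(t) dt` converge absolutely for `Re ζ > r`, `Re s > -1`, if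
`F = O(e^{rt})`. -/
lemma integrableOn_exp_mul_cpow_mul {F : ℝ → ℂ} (hF : ContinuousOn F (Ioi 0)) {C r : ℝ}
    (hb : ∀ t ∈ Ioi (0 : ℝ), ‖F t‖ ≤ C * Real.exp (r * t)) {s ζ : ℂ} (hs : -1 < s.re)
    (hζ : r < ζ.re) :
    IntegrableOn (fun t : ℝ => exp (-ζ * t) * ((t : ℂ) ^ s * F t)) (Ioi 0) := by
  have h := integrableOn_rpow_mul_exp_neg_mul_rpow hs zero_lt_one (sub_pos.2 hζ)
  simp only [Real.rpow_one] at h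
  refine (h.const_mul C).mono' ?_ ?_
  · refine ContinuousOn.aestronglyMeasurable ?_ measurableSet_Ioi
    refine ContinuousOn.mul (by fun_prop) (ContinuousOn.mul (fun t ht => ?_) hF)
    exact (continuousAt_ofReal_cpow_const t s (Or.inr (ne_of_gt ht))).continuousWithinAt
  · refine (ae_restrict_iff' measurableSet_Ioi).2 (Eventually.of_forall fun t ht => ?_)
    rw [norm_mul, norm_mul, norm_exp_neg_mul_ofReal, norm_cpow_eq_rpow_re_of_pos ht]
    have := Real.rpow_nonneg (le_of_lt ht) s.re
    calc Real.exp (-ζ.re * t) * (t ^ s.re * ‖F t‖)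
        ≤ Real.exp (-ζ.re * t) * (t ^ s.re * (C * Real.exp (r * t))) := by
          gcongr
          exact hb t ht
      _ = C * (t ^ s.re * (Real.exp (-ζ.re * t) * Real.exp (r * t))) := by ring
      _ = _ := by rw [← Real.exp_add]; ring_nf

/-- The Gamma integral `∫_0^∞ t^{s-1} e^{-ζt} dt = Γ(s) ζ^{-s}` for complex `ζ`, continued
analytically from `ζ > 0`. -/
lemma integral_exp_mul_cpow {s ζ : ℂ} (hs : -1 < s.re) (hζ : 0 < ζ.re) :
    ∫ t in Ioi (0 : ℝ), exp (-ζ * t) * (t : ℂ) ^ s = Gamma (s + 1) * ζ ^ (-(s + 1)) := by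
  have hUo : IsOpen {z : ℂ | 0 < z.re} := isOpen_lt continuous_const continuous_re
  have hint : ∀ z : ℂ, 0 < z.re →
      IntegrableOn (fun t : ℝ => exp (-z * t) * (t : ℂ) ^ s) (Ioi 0) := fun z hz => by
    simpa using integrableOn_exp_mul_cpow_mul (F := fun _ => 1) continuousOn_const (C := 1) (r := 0)
      (by simp) hs hz
  have hd : DifferentiableOn ℂ (fun z : ℂ => ∫ t in Ioi (0 : ℝ), exp (-z * t) * (t : ℂ) ^ s)
      {z : ℂ | 0 < z.re} := by
    intro z hz
    have hz : 0 < z.re := hz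
    refine (hasDerivAt_integral_of_holomorphic hUo
      (f := fun z (t : ℝ) => exp (-z * t) * (t : ℂ) ^ s)
      (fun w hw => (hint w hw).aestronglyMeasurable)
      (Eventually.of_forall fun t => by fun_prop) hz (half_pos hz)
      (hint ((z.re / 2 : ℝ) : ℂ) (by simpa using hz)).norm
      ?_).differentiableAt.differentiableWithinAt
    refine (ae_restrict_iff' measurableSet_Ioi).2 (Eventually.of_forall fun t ht w hw => ?_)
    have ht : 0 < t := ht
    rw [norm_mul, norm_mul, norm_exp_neg_mul_ofReal, norm_exp_neg_mul_ofReal, ofReal_re]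
    have h1 : ‖w - z‖ < z.re / 2 := by simpa [dist_eq] using hw.2
    have h2 : |(w - z).re| < z.re / 2 := (abs_re_le_norm _).trans_lt h1
    rw [sub_re] at h2
    have h3 : z.re / 2 ≤ w.re := by linarith [(abs_lt.1 h2).1]
    gcongr
  have hd2 : DifferentiableOn ℂ (fun z : ℂ => Gamma (s + 1) * z ^ (-(s + 1))) {z : ℂ | 0 < z.re} :=
    fun z hz => ((differentiableAt_id.cpow_const (Or.inl hz)).const_mul _).differentiableWithinAt
  refine AnalyticOnNhd.eqOn_of_preconnected_of_frequently_eq (hd.analyticOnNhd hUo)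
    (hd2.analyticOnNhd hUo) (convex_halfSpace_re_gt 0).isPreconnected (z₀ := 1) (by simp) ?_ hζ
  have hseq : Tendsto (fun n : ℕ => ((1 + 1 / ((n : ℝ) + 1) : ℝ) : ℂ)) atTop (𝓝[≠] 1) := by
    refine tendsto_nhdsWithin_iff.2 ⟨?_, Eventually.of_forall fun n => ?_⟩
    · have := tendsto_one_div_add_atTop_nhds_zero_nat (𝕜 := ℝ) |>.const_add 1
      rw [add_zero] at this
      exact (continuous_ofReal.tendsto' 1 1 ofReal_one).comp this
    · have : (0 : ℝ) < 1 / ((n : ℝ) + 1) := by positivity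
      simp only [mem_compl_iff, mem_singleton_iff, ofReal_eq_one]
      linarith
  refine hseq.frequently (Frequently.of_forall fun n => ?_)
  set x : ℝ := 1 + 1 / ((n : ℝ) + 1)
  have hx : 0 < x := by positivity
  have := integral_cpow_mul_exp_neg_mul_Ioi (a := s + 1) (by simp; linarith) hx
  rw [add_sub_cancel_right, one_div, inv_cpow _ _ (by
    rw [arg_ofReal_of_nonneg hx.le]; exact Real.pi_pos.ne), ← cpow_neg, mul_comm] at this
  rw [← this]
  refine integral_congr_ae (Eventually.of_forall fun t => ?_)
  simp only
  rw [mul_comm, neg_mul]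

namespace HasType

variable {a R : ℝ} {F : ℂ → ℂ}

lemma continuousOn_ofReal (hF : HasType a R F) (ha : 0 < a) :
    ContinuousOn (fun t : ℝ => F t) (Ioi 0) :=
  hF.diff.continuousOn.comp (by fun_prop) fun _ hx => ofReal_mem_region ha (le_of_lt hx)

lemma integrableOn_laplace (hF : HasType a R F) (ha : 0 < a) {s ζ : ℂ} (hs : -1 < s.re)
    (hζ : R < ζ.re) :
    IntegrableOn (fun t : ℝ => exp (-ζ * t) * ((t : ℂ) ^ s * F t)) (Ioi 0) := by
  obtain ⟨C, hC⟩ := hF.bound ((R + ζ.re) / 2) (by linarith) (a / 2) (by linarith) (by linarith)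
  refine integrableOn_exp_mul_cpow_mul (hF.continuousOn_ofReal ha) (r := (R + ζ.re) / 2) (C := C)
    (fun t ht => ?_) hs (by linarith)
  have := hC t (ofReal_mem_region (by linarith) (le_of_lt ht))
  rwa [norm_real, Real.norm_of_nonneg (le_of_lt ht)] at this

end HasType

/-! ### Taylor coefficients -/

/-- `u` is the sequence of Taylor coefficients of `F` at `0`, with convergence in `|t| < a`. -/
def HasTaylor (a : ℝ) (u : ℕ → ℂ) (F : ℂ → ℂ) : Prop :=
  ∀ t ∈ Metric.ball (0 : ℂ) a, HasSum (fun n => u n * t ^ n) (F t)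

lemma HasTaylor.summable_norm {a : ℝ} {u : ℕ → ℂ} {F : ℂ → ℂ} (h : HasTaylor a u F) {ρ : ℝ}
    (hρ : 0 ≤ ρ) (hρa : ρ < a) : Summable fun n => ‖u n‖ * ρ ^ n := by
  have := (h (ρ : ℂ) (by simpa [abs_of_nonneg hρ] using hρa)).summable.norm
  simpa [abs_of_nonneg hρ] using this

/-! ### Euler's fractional integral -/

/-- The operator with `t^n ↦ Γ(α+n+1)/Γ(β+n+1) t^n`, given by Euler's Beta integral. Up to powers of
`t` it is the Riemann–Liouville fractional integral of order `β - α`. -/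
def eulerOp (α β : ℂ) (F : ℂ → ℂ) (t : ℂ) : ℂ :=
  (Gamma (β - α))⁻¹ * ∫ s in (0 : ℝ)..1, (s : ℂ) ^ α * (1 - (s : ℂ)) ^ (β - α - 1) * F (t * s)

section Euler

variable {α β : ℂ}

lemma integrable_eulerWeight (hα : -1 < α.re) (hβ : α.re < β.re) :
    IntegrableOn (fun s : ℝ => (s : ℂ) ^ α * (1 - (s : ℂ)) ^ (β - α - 1)) (Ioc 0 1) := by
  have := betaIntegral_convergent (u := α + 1) (v := β - α) (by simp; linarith) (by simp; linarith)
  rw [intervalIntegrable_iff_integrableOn_Ioc_of_le zero_le_one] at this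
  simpa using this

lemma HasType.integrable_eulerOp {a R : ℝ} {F : ℂ → ℂ} (hF : HasType a R F)
    (hα : -1 < α.re) (hβ : α.re < β.re) {t : ℂ} (ht : t ∈ region a) :
    IntegrableOn (fun s : ℝ => (s : ℂ) ^ α * (1 - (s : ℂ)) ^ (β - α - 1) * F (t * s))
      (Ioc 0 1) := by
  have hc : ContinuousOn (fun s : ℝ => F (t * s)) (Icc 0 1) :=
    hF.diff.continuousOn.comp (by fun_prop) fun s hs => smul_mem_region ht hs.1 hs.2
  obtain ⟨C, hC⟩ := isCompact_Icc.exists_bound_of_continuousOn hc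
  refine (integrable_eulerWeight hα hβ).mul_bdd (c := C)
    ((hc.mono Ioc_subset_Icc_self).aestronglyMeasurable measurableSet_Ioc) ?_
  exact (ae_restrict_iff' measurableSet_Ioc).2
    (Eventually.of_forall fun s hs => hC s (Ioc_subset_Icc_self hs))

lemma HasType.eulerOp {a R : ℝ} (hR : 0 ≤ R) {F : ℂ → ℂ} (hF : HasType a R F)
    (hα : -1 < α.re) (hβ : α.re < β.re) : HasType a R (eulerOp α β F) where
  diff := by
    intro t₀ ht₀
    have h0 : 0 ≤ Metric.infDist t₀ ((fun x : ℝ => (x : ℂ)) '' Ioi 0) := Metric.infDist_nonneg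
    have h1 : Metric.infDist t₀ ((fun x : ℝ => (x : ℂ)) '' Ioi 0) < a := ht₀
    obtain ⟨A, hA1, hA2⟩ := exists_between h1
    obtain ⟨C, hC⟩ := hF.bound (R + 1) (by linarith) A (by linarith) hA2
    have hC0 : 0 ≤ C := nonneg_of_mul_nonneg_left
      ((norm_nonneg _).trans (hC 0 (zero_mem_region (by linarith)))) (Real.exp_pos _)
    have key := hasDerivAt_integral_of_holomorphic (μ := volume.restrict (Ioc (0 : ℝ) 1))
      (isOpen_region A)
      (f := fun t s => (s : ℂ) ^ α * (1 - (s : ℂ)) ^ (β - α - 1) * F (t * s))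
      (fun t ht => (hF.integrable_eulerOp hα hβ (region_mono hA2.le ht)).aestronglyMeasurable)
      ((ae_restrict_iff' measurableSet_Ioc).2 (Eventually.of_forall fun s hs =>
        (hF.diff.comp (t := region a) (by fun_prop) fun t ht =>
          smul_mem_region (region_mono hA2.le ht) hs.1.le hs.2).const_mul _))
      (t₀ := t₀) hA1 zero_lt_one
      ((integrable_eulerWeight hα hβ).norm.mul_const (C * Real.exp ((R + 1) * (‖t₀‖ + 1))))
      ((ae_restrict_iff' measurableSet_Ioc).2 (Eventually.of_forall fun s hs t ht => by
        rw [norm_mul]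
        gcongr
        refine (hC _ (smul_mem_region ht.1 hs.1.le hs.2)).trans ?_
        have h2 : ‖t‖ ≤ ‖t₀‖ + 1 := by
          have h3 : ‖t - t₀‖ < 1 := by simpa [dist_eq] using ht.2
          linarith [norm_le_norm_add_norm_sub' t t₀]
        have h4 : ‖t * s‖ ≤ ‖t₀‖ + 1 := by
          rw [norm_mul, norm_real, Real.norm_of_nonneg hs.1.le]
          exact (mul_le_of_le_one_right (norm_nonneg _) hs.2).trans h2
        gcongr))
    unfold FracCalc.eulerOp
    simp only [intervalIntegral.integral_of_le zero_le_one]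
    exact (key.differentiableAt.const_mul _).differentiableWithinAt
  bound r hr A hA hAa := by
    obtain ⟨C, hC⟩ := hF.bound r hr A hA hAa
    have hC0 : 0 ≤ C := nonneg_of_mul_nonneg_left
      ((norm_nonneg _).trans (hC 0 (zero_mem_region hA))) (Real.exp_pos _)
    have hr0 : 0 ≤ r := hR.trans hr.le
    refine ⟨‖(Gamma (β - α))⁻¹‖ *
      ((∫ s in Ioc (0 : ℝ) 1, ‖(s : ℂ) ^ α * (1 - (s : ℂ)) ^ (β - α - 1)‖) * C), fun t ht => ?_⟩
    unfold FracCalc.eulerOp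
    rw [intervalIntegral.integral_of_le zero_le_one, norm_mul, mul_assoc, mul_assoc]
    gcongr
    rw [← integral_mul_const]
    refine norm_integral_le_of_norm_le ((integrable_eulerWeight hα hβ).norm.mul_const _)
      ((ae_restrict_iff' measurableSet_Ioc).2 (Eventually.of_forall fun s hs => ?_))
    rw [norm_mul]
    gcongr
    refine (hC _ (smul_mem_region ht hs.1.le hs.2)).trans ?_
    have h4 : ‖t * s‖ ≤ ‖t‖ := by
      rw [norm_mul, norm_real, Real.norm_of_nonneg hs.1.le]
      exact mul_le_of_le_one_right (norm_nonneg _) hs.2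
    gcongr

/-- Integrated against the weight of `eulerOp`, each monomial gives a Beta integral. -/
lemma HasTaylor.eulerOp {a : ℝ} {u : ℕ → ℂ} {F : ℂ → ℂ} (hF : HasTaylor a u F)
    (hα : -1 < α.re) (hβ : α.re < β.re) :
    HasTaylor a (fun n => Gamma (α + n + 1) / Gamma (β + n + 1) * u n) (eulerOp α β F) := by
  intro t ht
  have ht' : ‖t‖ < a := by simpa using ht
  have hw := integrable_eulerWeight hα hβ
  have hterm : ∀ n : ℕ, IntegrableOn (fun s : ℝ => (s : ℂ) ^ α * (1 - (s : ℂ)) ^ (β - α - 1) *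
      (u n * (t * s) ^ n)) (Ioc 0 1) := by
    intro n
    refine hw.mul_bdd (c := ‖u n‖ * ‖t‖ ^ n) (Continuous.aestronglyMeasurable (by fun_prop)) ?_
    refine (ae_restrict_iff' measurableSet_Ioc).2 (Eventually.of_forall fun s hs => ?_)
    rw [norm_mul, norm_pow, norm_mul, norm_real, Real.norm_of_nonneg hs.1.le]
    have := hs.1.le
    gcongr
    exact mul_le_of_le_one_right (norm_nonneg _) hs.2
  have hsum := hasSum_integral_of_summable_integral_norm (μ := volume.restrict (Ioc (0 : ℝ) 1))
    hterm (by
      refine Summable.of_nonneg_of_le (fun n => by positivity) (fun n => ?_)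
        ((hF.summable_norm (norm_nonneg t) ht').mul_left
          (∫ s in Ioc (0 : ℝ) 1, ‖(s : ℂ) ^ α * (1 - (s : ℂ)) ^ (β - α - 1)‖))
      rw [← integral_mul_const]
      refine integral_mono_ae (hterm n).norm (hw.norm.mul_const _)
        ((ae_restrict_iff' measurableSet_Ioc).2 (Eventually.of_forall fun s hs => ?_))
      simp only [norm_mul, norm_pow, norm_real, Real.norm_of_nonneg hs.1.le]
      have := hs.1.le
      gcongr
      exact mul_le_of_le_one_right (norm_nonneg _) hs.2)
  have heq : ∫ s in Ioc (0 : ℝ) 1, ∑' n : ℕ, (s : ℂ) ^ α * (1 - (s : ℂ)) ^ (β - α - 1) *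
      (u n * (t * s) ^ n) = ∫ s in (0 : ℝ)..1, (s : ℂ) ^ α * (1 - (s : ℂ)) ^ (β - α - 1) *
      F (t * s) := by
    rw [intervalIntegral.integral_of_le zero_le_one]
    refine setIntegral_congr_fun measurableSet_Ioc fun s hs => ?_
    rw [tsum_mul_left, (hF (t * s) _).tsum_eq]
    rw [mem_ball_zero_iff, norm_mul, norm_real, Real.norm_of_nonneg hs.1.le]
    exact (mul_le_of_le_one_right (norm_nonneg _) hs.2).trans_lt ht'
  rw [heq] at hsum
  refine (hsum.mul_left (Gamma (β - α))⁻¹).congr_fun fun n => ?_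
  -- each term is a Beta integral
  have h1 : (0 : ℝ) < (α + n + 1).re := by
    simp; linarith [n.cast_nonneg (α := ℝ)]
  have h2 : (0 : ℝ) < (β - α).re := by simp; linarith
  have hbeta := Gamma_mul_Gamma_eq_betaIntegral h1 h2
  have hG2 : Gamma (β - α) ≠ 0 := Gamma_ne_zero_of_re_pos h2
  have hG3 : Gamma (β + n + 1) ≠ 0 := Gamma_ne_zero_of_re_pos (by
    simp; linarith [n.cast_nonneg (α := ℝ)])
  rw [show α + n + 1 + (β - α) = β + n + 1 by ring] at hbeta
  have hint : ∫ s in Ioc (0 : ℝ) 1, (s : ℂ) ^ α * (1 - (s : ℂ)) ^ (β - α - 1) *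
      (u n * (t * s) ^ n) = u n * t ^ n * betaIntegral (α + n + 1) (β - α) := by
    rw [betaIntegral, intervalIntegral.integral_of_le zero_le_one, ← integral_const_mul]
    refine setIntegral_congr_fun measurableSet_Ioc fun s hs => ?_
    rw [add_sub_cancel_right, cpow_add _ _ (by exact_mod_cast hs.1.ne'), cpow_natCast]
    ring
  rw [hint, eq_div_of_mul_eq hG3 ((mul_comm _ _).trans hbeta.symm)]
  field_simp

/-- `𝓛_β (E F) = 𝓛_α F` for Euler's fractional integral `E`: `t^β E F` is
the convolution of `t^α F` with `t^{β-α-1}/Γ(β-α)`, whose Laplace transform is `ζ^{α-β}`. -/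
lemma HasType.laplace_eulerOp {a R : ℝ} (ha : 0 < a) (hR : 0 ≤ R) {F : ℂ → ℂ} (hF : HasType a R F)
    (hα : -1 < α.re) (hβ : α.re < β.re) {ζ : ℂ} (hζ : R < ζ.re) :
    ζ ^ (β + 1) * ∫ t in Ioi (0 : ℝ), exp (-ζ * t) * ((t : ℂ) ^ β * FracCalc.eulerOp α β F t) =
      ζ ^ (α + 1) * ∫ t in Ioi (0 : ℝ), exp (-ζ * t) * ((t : ℂ) ^ α * F t) := by
  have hγ : -1 < (β - α - 1).re := by simp; linarith
  have hζ0 : 0 < ζ.re := hR.trans_lt hζ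
  have hζne : ζ ≠ 0 := fun h => by simp [h] at hζ0
  have hG : Gamma (β - α) ≠ 0 := Gamma_ne_zero_of_re_pos (by simp; linarith)
  have hg : IntegrableOn (fun t : ℝ => exp (-ζ * t) * (t : ℂ) ^ (β - α - 1)) (Ioi 0) := by
    simpa using integrableOn_exp_mul_cpow_mul (F := fun _ => 1) continuousOn_const (C := 1) (r := 0)
      (by simp) hγ hζ0
  have hconv := integral_posConvolution (hF.integrableOn_laplace ha hα hζ) hg
    (ContinuousLinearMap.mul ℝ ℂ)
  simp only [ContinuousLinearMap.mul_apply'] at hconv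
  rw [integral_exp_mul_cpow hγ hζ0, sub_add_cancel] at hconv
  have hin : ∀ x ∈ Ioi (0 : ℝ), (∫ t in (0 : ℝ)..x, exp (-ζ * t) * ((t : ℂ) ^ α * F t) *
      (exp (-ζ * (x - t : ℝ)) * ((x - t : ℝ) : ℂ) ^ (β - α - 1))) =
      Gamma (β - α) * (exp (-ζ * x) * ((x : ℂ) ^ β * FracCalc.eulerOp α β F x)) := by
    intro x hx
    have hx : 0 < x := hx
    have hxne : (x : ℂ) ≠ 0 := by exact_mod_cast hx.ne'
    have hsub := intervalIntegral.smul_integral_comp_mul_left (a := 0) (b := 1)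
      (f := fun t : ℝ => exp (-ζ * t) * ((t : ℂ) ^ α * F t) *
      (exp (-ζ * (x - t : ℝ)) * ((x - t : ℝ) : ℂ) ^ (β - α - 1))) x
    rw [mul_zero, mul_one] at hsub
    rw [← hsub, FracCalc.eulerOp]
    rw [show Gamma (β - α) * (exp (-ζ * x) * ((x : ℂ) ^ β * ((Gamma (β - α))⁻¹ *
        ∫ s in (0 : ℝ)..1, (s : ℂ) ^ α * (1 - (s : ℂ)) ^ (β - α - 1) * F (x * s)))) =
        exp (-ζ * x) * (x : ℂ) ^ β *
        ∫ s in (0 : ℝ)..1, (s : ℂ) ^ α * (1 - (s : ℂ)) ^ (β - α - 1) * F (x * s) by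
        field_simp]
    rw [real_smul, ← intervalIntegral.integral_const_mul, ← intervalIntegral.integral_const_mul]
    refine intervalIntegral.integral_congr fun s hs => ?_
    rw [uIcc_of_le zero_le_one] at hs
    rw [show x - x * s = x * (1 - s) by ring, ofReal_mul, ofReal_mul,
      mul_cpow_ofReal_nonneg hx.le hs.1, mul_cpow_ofReal_nonneg hx.le (sub_nonneg.2 hs.2)]
    have e1 : exp (-ζ * x) = exp (-ζ * (x * s)) * exp (-ζ * (x * (1 - s : ℝ))) := by
      rw [← Complex.exp_add]; push_cast; ring_nf
    have e2 : (x : ℂ) ^ β = x * x ^ α * x ^ (β - α - 1) := by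
      nth_rewrite 2 [← cpow_one (x : ℂ)]
      rw [← cpow_add _ _ hxne, ← cpow_add _ _ hxne]; ring_nf
    rw [e1, e2]
    push_cast
    ring
  rw [setIntegral_congr_fun measurableSet_Ioi hin, integral_const_mul] at hconv
  have e3 : ζ ^ (β + 1) * ζ ^ (-(β - α)) = ζ ^ (α + 1) := by
    rw [← cpow_add _ _ hζne]; ring_nf
  rw [← e3]
  apply mul_left_cancel₀ hG
  linear_combination ζ ^ (β + 1) * hconv

end Euler

/-! ### The differential operators `β + t d/dt` -/

/-- The operator `β + t d/dt`, with `t^n ↦ (β + n) t^n`. -/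
def thetaOp (β : ℂ) (F : ℂ → ℂ) (t : ℂ) : ℂ := β * F t + t * deriv F t

lemma HasType.thetaOp {a R : ℝ} (hR : 0 ≤ R) {F : ℂ → ℂ} (hF : HasType a R F) (β : ℂ) :
    HasType a R (thetaOp β F) where
  diff := (hF.diff.const_mul β).add (differentiableOn_id.mul (hF.diff.deriv (isOpen_region a)))
  bound r hr A hA hAa := by
    set r' := (R + r) / 2
    have hr' : 0 ≤ r' := by simp only [r']; linarith
    have hrr' : 0 < r - r' := by simp only [r']; linarith
    set δ := (a - A) / 4
    have hδ : 0 < δ := by simp only [δ]; linarith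
    obtain ⟨C, hC⟩ := hF.bound r' (by simp only [r']; linarith) (A + 2 * δ) (by linarith)
      (by simp only [δ]; linarith)
    have hC0 : 0 ≤ C := nonneg_of_mul_nonneg_left
      ((norm_nonneg _).trans (hC 0 (zero_mem_region (by linarith)))) (Real.exp_pos _)
    -- Cauchy's estimate on discs of radius `δ`; the factor `t` costs the gap between `r'` and `r`
    refine ⟨‖β‖ * C + C * Real.exp (r' * δ) / δ / (r - r'), fun t ht => ?_⟩
    have hd : ‖deriv F t‖ ≤ C * Real.exp (r' * (‖t‖ + δ)) / δ := by
      have hsub : Metric.closedBall t δ ⊆ region (A + 2 * δ) :=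
        closedBall_subset_region (by linarith) ht
      refine norm_deriv_le_of_forall_mem_sphere_norm_le hδ
        (DifferentiableOn.diffContOnCl_ball hF.diff (hsub.trans (region_mono ?_))) fun z hz => ?_
      · simp only [δ]; linarith
      · refine (hC z (hsub (Metric.sphere_subset_closedBall hz))).trans ?_
        have h1 : ‖z - t‖ = δ := by simpa [dist_eq] using hz
        have h2 : ‖z‖ ≤ ‖t‖ + δ := by linarith [norm_le_norm_add_norm_sub' z t]
        gcongr
    have hx : ‖t‖ ≤ Real.exp ((r - r') * ‖t‖) / (r - r') := by
      rw [le_div_iff₀ hrr']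
      linarith [Real.add_one_le_exp ((r - r') * ‖t‖)]
    have hFt : ‖F t‖ ≤ C * Real.exp (r * ‖t‖) := by
      refine (hC t (region_mono (by linarith) ht)).trans ?_
      gcongr
      linarith
    calc ‖FracCalc.thetaOp β F t‖ ≤ ‖β‖ * ‖F t‖ + ‖t‖ * ‖deriv F t‖ := by
          rw [← norm_mul, ← norm_mul]; exact norm_add_le _ _
      _ ≤ ‖β‖ * (C * Real.exp (r * ‖t‖)) + Real.exp ((r - r') * ‖t‖) / (r - r') *
          (C * Real.exp (r' * (‖t‖ + δ)) / δ) := by gcongr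
      _ = ‖β‖ * C * Real.exp (r * ‖t‖) + C * (Real.exp (r' * δ) *
          (Real.exp ((r - r') * ‖t‖) * Real.exp (r' * ‖t‖))) / δ / (r - r') := by
          rw [mul_add r', Real.exp_add]; ring
      _ = _ := by
          rw [← Real.exp_add ((r - r') * ‖t‖)]
          ring_nf

lemma HasTaylor.hasSum_deriv {a : ℝ} {u : ℕ → ℂ} {F : ℂ → ℂ} (hF : HasTaylor a u F) {t : ℂ}
    (ht : t ∈ Metric.ball (0 : ℂ) a) : HasSum (fun n => u n * (n * t ^ (n - 1))) (deriv F t) := by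
  obtain ⟨ρ, hρ1, hρ2⟩ := exists_between (show ‖t‖ < a by simpa using ht)
  have hρ0 : 0 ≤ ρ := (norm_nonneg _).trans hρ1.le
  have hder := hasSum_deriv_of_summable_norm (F := fun n z => u n * z ^ n)
    (hF.summable_norm hρ0 hρ2) (fun n => by fun_prop) (Metric.isOpen_ball (x := (0 : ℂ)) (ε := ρ))
    (fun n w hw => by
      have : ‖w‖ < ρ := by simpa using hw
      rw [norm_mul, norm_pow]
      gcongr) (show t ∈ Metric.ball 0 ρ by simpa using hρ1)
  have heq : (fun w => ∑' n, u n * w ^ n) =ᶠ[𝓝 t] F := by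
    filter_upwards [Metric.isOpen_ball.mem_nhds ht] with w hw using (hF w hw).tsum_eq
  rw [heq.deriv_eq] at hder
  refine hder.congr_fun fun n => ?_
  simp

lemma HasTaylor.thetaOp {a : ℝ} {u : ℕ → ℂ} {F : ℂ → ℂ} (hF : HasTaylor a u F) (β : ℂ) :
    HasTaylor a (fun n => (β + n) * u n) (thetaOp β F) := by
  intro t ht
  refine (((hF t ht).mul_left β).add ((hF.hasSum_deriv ht).mul_left t)).congr_fun fun n => ?_
  rcases n with _ | n
  · simp
  · simp only [Nat.add_sub_cancel, pow_succ]; ring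

/-- `𝓛_j ((j + 1 + t d/dt) F) = 𝓛_{j+1} F`, as `t^j (j + 1 + t d/dt) F` is the derivative of
`t^{j+1} F`. -/
lemma HasType.laplace_thetaOp {a R : ℝ} (ha : 0 < a) (hR : 0 ≤ R) {F : ℂ → ℂ}
    (hF : HasType a R F) (j : ℕ) {ζ : ℂ} (hζ : R < ζ.re) :
    ∫ t in Ioi (0 : ℝ), exp (-ζ * t) * ((t : ℂ) ^ j * FracCalc.thetaOp (j + 1) F t) =
      ζ * ∫ t in Ioi (0 : ℝ), exp (-ζ * t) * ((t : ℂ) ^ (j + 1) * F t) := by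
  have hi : ∀ (k : ℕ) {G : ℂ → ℂ}, HasType a R G →
      IntegrableOn (fun t : ℝ => exp (-ζ * t) * ((t : ℂ) ^ k * G t)) (Ioi 0) := fun k G hG => by
    simpa using hG.integrableOn_laplace ha (s := k)
      (by simp; linarith [k.cast_nonneg (α := ℝ)]) hζ
  have h1 := hi j (hF.thetaOp hR (j + 1))
  have h2 := (hi (j + 1) hF).const_mul ζ
  have hFd : ∀ x : ℝ, 0 ≤ x → HasDerivAt (fun t : ℝ => F t) (deriv F x) x := fun x hx => by
    have hx' := ofReal_mem_region ha hx
    exact ((hF.diff _ hx').differentiableAt ((isOpen_region a).mem_nhds hx')).hasDerivAt.comp_ofReal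
  have hder : ∀ x : ℝ, 0 ≤ x → HasDerivAt
      (fun t : ℝ => exp (-ζ * t) * ((t : ℂ) ^ (j + 1) * F t))
      (exp (-ζ * x) * ((x : ℂ) ^ j * FracCalc.thetaOp (j + 1) F x) -
        ζ * (exp (-ζ * x) * ((x : ℂ) ^ (j + 1) * F x))) x := by
    intro x hx
    have e1 : HasDerivAt (fun t : ℝ => exp (-ζ * t)) (exp (-ζ * x) * (-ζ * 1)) x :=
      ((ofRealCLM.hasDerivAt (x := x)).const_mul (-ζ)).cexp
    have e2 : HasDerivAt (fun t : ℝ => (t : ℂ) ^ (j + 1)) (((j + 1 : ℕ) : ℂ) * x ^ j * 1) x :=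
      (ofRealCLM.hasDerivAt (x := x)).pow (j + 1)
    refine (e1.mul (e2.mul (hFd x hx))).congr_deriv ?_
    simp only [FracCalc.thetaOp, Pi.mul_apply]
    push_cast
    ring
  have hlim := tendsto_zero_of_hasDerivAt_of_integrableOn_Ioi
    (fun x hx => hder x (le_of_lt hx)) (h1.sub h2) (hi (j + 1) hF)
  have := integral_Ioi_of_hasDerivAt_of_tendsto
    (hder 0 le_rfl).continuousAt.continuousWithinAt (fun x hx => hder x (le_of_lt hx))
    (h1.sub h2) hlim
  rw [integral_sub h1 h2, integral_const_mul] at this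
  simpa [sub_eq_zero] using this

/-- The composition `(1 + t d/dt) ⋯ (m + t d/dt)` turns `𝓛_m` into `𝓛_0`. -/
lemma HasType.exists_thetaOp_iterate {a R : ℝ} (ha : 0 < a) (hR : 0 ≤ R) (m : ℕ) :
    ∀ {F : ℂ → ℂ}, HasType a R F → ∃ G, HasType a R G ∧
      (∀ ζ : ℂ, R < ζ.re → ∫ t in Ioi (0 : ℝ), exp (-ζ * t) * G t =
        ζ ^ m * ∫ t in Ioi (0 : ℝ), exp (-ζ * t) * ((t : ℂ) ^ m * F t)) ∧
      ∀ (b : ℝ) (u : ℕ → ℂ), HasTaylor b u F →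
        HasTaylor b (fun n => Gamma (m + n + 1) / n.factorial * u n) G := by
  induction m with
  | zero =>
    intro F hF
    refine ⟨F, hF, fun ζ _ => by simp, fun b u hu => ?_⟩
    convert hu using 2 with n
    have : (n.factorial : ℂ) ≠ 0 := by exact_mod_cast n.factorial_ne_zero
    rw [Nat.cast_zero, zero_add, Gamma_nat_eq_factorial, div_self this, one_mul]
  | succ m ih =>
    intro F hF
    obtain ⟨G, hG1, hG2, hG3⟩ := ih (hF.thetaOp hR (m + 1))
    refine ⟨G, hG1, fun ζ hζ => ?_, fun b u hu => ?_⟩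
    · rw [hG2 ζ hζ, hF.laplace_thetaOp ha hR m hζ]; ring
    · convert hG3 b _ (hu.thetaOp (m + 1)) using 2 with n
      have h : ((m + n + 1 : ℕ) : ℂ) ≠ 0 := by exact_mod_cast Nat.succ_ne_zero (m + n)
      push_cast at h ⊢
      rw [show (m + 1 + n + 1 : ℂ) = (m + n + 1) + 1 by ring, Gamma_add_one _ h]
      ring

/-- Existence of the fractional derivative, as `(1 + t d/dt) ⋯ (m + t d/dt)` applied to an Euler
integral, together with its transform and its Taylor coefficients. -/
lemma HasType.exists_fracDeriv {a R : ℝ} (ha : 0 < a) (hR : 0 ≤ R) {F : ℂ → ℂ}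
    (hF : HasType a R F) {α : ℂ} (hα : -1 < α.re) :
    ∃ G, HasType a R G ∧ (∀ ζ : ℂ, R < ζ.re → laplace G ζ = laplaceAlpha α F ζ) ∧
      ∀ (b : ℝ) (u : ℕ → ℂ), HasTaylor b u F →
        HasTaylor b (fun n => Gamma (α + n + 1) / n.factorial * u n) G := by
  obtain ⟨m, hm⟩ := exists_nat_gt α.re
  have hm' : α.re < (m : ℂ).re := by simpa using hm
  obtain ⟨G, hG1, hG2, hG3⟩ := (hF.eulerOp hR hα hm').exists_thetaOp_iterate ha hR m
  refine ⟨G, hG1, fun ζ hζ => ?_, fun b u hu => ?_⟩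
  · have hζ0 : 0 < ζ.re := hR.trans_lt hζ
    have hζne : ζ ≠ 0 := fun h => by simp [h] at hζ0
    have h := hF.laplace_eulerOp ha hR hα hm' hζ
    rw [cpow_add _ _ hζne, cpow_add _ _ hζne, cpow_one, cpow_natCast] at h
    simp only [cpow_natCast] at h
    rw [laplace, laplaceAlpha, laplace, hG2 ζ hζ]
    linear_combination h
  · convert hG3 b _ (hu.eulerOp hα hm') using 2 with n
    have h : Gamma ((m : ℂ) + n + 1) ≠ 0 := Gamma_ne_zero_of_re_pos (by
      simp; positivity)
    field_simp

/-! ### Injectivity of the Laplace transform -/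

/-- A continuous function on `(0, ∞)` whose Laplace integrals vanish on a vertical line, where
they converge absolutely, is zero: this is Fourier inversion on that line. -/
lemma eq_zero_of_laplace_eq_zero {D : ℝ → ℂ} (hD : ContinuousOn D (Ioi 0)) {c : ℝ}
    (hint : IntegrableOn (fun t : ℝ => exp (-(c : ℂ) * t) * D t) (Ioi 0))
    (hzero : ∀ w : ℝ, ∫ t in Ioi (0 : ℝ), exp (-(c + w * I) * t) * D t = 0) :
    ∀ t ∈ Ioi (0 : ℝ), D t = 0 := by
  intro t ht
  set k : ℝ → ℂ := (Ioi (0 : ℝ)).indicator fun t : ℝ => exp (-(c : ℂ) * t) * D t with hk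
  have hki : Integrable k := hint.integrable_indicator measurableSet_Ioi
  have hF : FourierTransform.fourier k = 0 := by
    ext w
    rw [Real.fourier_real_eq_integral_exp_smul]
    have : (fun v : ℝ => exp (↑(-2 * Real.pi * v * w) * I) • k v) =
        (Ioi (0 : ℝ)).indicator fun t : ℝ =>
          exp (-(c + (2 * Real.pi * w : ℝ) * I) * t) * D t := by
      ext v
      simp only [hk, indicator, smul_eq_mul]
      split_ifs
      · rw [← mul_assoc, ← Complex.exp_add]
        congr 2
        push_cast
        ring
      · simp
    rw [this, integral_indicator measurableSet_Ioi, hzero]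
    rfl
  have hkc : ContinuousAt k t := by
    have : k =ᶠ[𝓝 t] fun t : ℝ => exp (-(c : ℂ) * t) * D t := by
      filter_upwards [Ioi_mem_nhds (show (0 : ℝ) < t from ht)] with s hs
      exact indicator_of_mem hs _
    refine ContinuousAt.congr ?_ this.symm
    exact ContinuousAt.mul (by fun_prop) (hD.continuousAt (Ioi_mem_nhds ht))
  have hinv := hki.fourierInv_fourier_eq (by rw [hF]; exact integrable_zero _ _ _) hkc
  rw [hF] at hinv
  have hk0 : k t = 0 := by
    rw [← hinv, Real.fourierInv_eq]; simp
  rw [hk, indicator_of_mem ht] at hk0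
  exact (mul_eq_zero.1 hk0).resolve_left (exp_ne_zero _)

lemma HasType.eqOn_of_laplace_eq {a b R S : ℝ} (ha : 0 < a) (hb : 0 < b) {F G : ℂ → ℂ}
    (hF : HasType a R F) (hG : HasType b S G) {ρ : ℝ}
    (h : ∀ ζ : ℂ, ρ < ζ.re → laplace F ζ = laplace G ζ) : EqOn F G (region a ∩ region b) := by
  have hpos : ∀ t ∈ Ioi (0 : ℝ), F t - G t = 0 := by
    set c := max (max ρ 0) (max R S) + 1
    have hc1 : ρ < c := by
      simp only [c]; linarith [le_max_left ρ 0, le_max_left (max ρ 0) (max R S)]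
    have hc0 : 0 < c := by
      simp only [c]; linarith [le_max_right ρ 0, le_max_left (max ρ 0) (max R S)]
    have hcR : R < c := by
      simp only [c]; linarith [le_max_left R S, le_max_right (max ρ 0) (max R S)]
    have hcS : S < c := by
      simp only [c]; linarith [le_max_right R S, le_max_right (max ρ 0) (max R S)]
    have hiF : ∀ w : ℝ, IntegrableOn (fun t : ℝ => exp (-(c + w * I) * t) * F t) (Ioi 0) :=
      fun w => by simpa using hF.integrableOn_laplace ha (s := 0) (ζ := c + w * I) (by simp)
                    (by simpa using hcR)
    have hiG : ∀ w : ℝ, IntegrableOn (fun t : ℝ => exp (-(c + w * I) * t) * G t) (Ioi 0) :=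
      fun w => by simpa using hG.integrableOn_laplace hb (s := 0) (ζ := c + w * I) (by simp)
                    (by simpa using hcS)
    refine eq_zero_of_laplace_eq_zero
      ((hF.continuousOn_ofReal ha).sub (hG.continuousOn_ofReal hb)) (c := c) ?_ fun w => ?_
    · have h0 := (hiF 0).sub (hiG 0)
      simp only [ofReal_zero, zero_mul, add_zero] at h0
      simp only [mul_sub]
      exact h0
    · simp only [mul_sub]
      rw [integral_sub (hiF w) (hiG w), sub_eq_zero]
      have := h (c + w * I) (by simpa using hc1)
      refine mul_left_cancel₀ ?_ this
      intro h0
      have := congrArg re h0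
      simp at this
      linarith
  have hopen := (isOpen_region a).inter (isOpen_region b)
  have h1 : (1 : ℂ) ∈ region a ∩ region b := by
    have := ofReal_mem_region ha zero_le_one
    have := ofReal_mem_region hb zero_le_one
    simp_all
  refine AnalyticOnNhd.eqOn_of_preconnected_of_frequently_eq
    ((hF.diff.mono inter_subset_left).analyticOnNhd hopen)
    ((hG.diff.mono inter_subset_right).analyticOnNhd hopen)
    ((convex_region a).inter (convex_region b)).isPreconnected h1 ?_
  have hseq : Tendsto (fun x : ℝ => (x : ℂ)) (𝓝[>] 1) (𝓝[≠] 1) := by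
    refine tendsto_nhdsWithin_iff.2
      ⟨(continuous_ofReal.tendsto' 1 1 ofReal_one).mono_left nhdsWithin_le_nhds, ?_⟩
    filter_upwards [self_mem_nhdsWithin] with x hx
    have hx : 1 < x := hx
    simp only [mem_compl_iff, mem_singleton_iff, ofReal_eq_one]
    exact hx.ne'
  refine hseq.frequently (Eventually.frequently ?_)
  filter_upwards [self_mem_nhdsWithin] with x hx
  exact sub_eq_zero.1 (hpos x (lt_trans zero_lt_one (show (1 : ℝ) < x from hx)))

/-- Any inverse transform of `𝓛_α F` in some `H(a, R)` gives the values of `fracDeriv`. -/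
lemma IsFracDeriv.fracDeriv_eq {α : ℂ} {F G : ℂ → ℂ} {a R : ℝ} (h : IsFracDeriv α F a R G) :
    EqOn (fracDeriv α F) G (region a) := by
  intro t ht
  have hex : ∃ G : ℂ → ℂ, ∃ a R : ℝ, IsFracDeriv α F a R G ∧ t ∈ region a := ⟨G, a, R, h, ht⟩
  rw [fracDeriv, dif_pos hex]
  obtain ⟨b, S, hb, htb⟩ := hex.choose_spec
  obtain ⟨hb0, hS0, hmem, ρ, hρ⟩ := hb
  obtain ⟨ha0, hR0, hmem', ρ', hρ'⟩ := h
  refine HasType.eqOn_of_laplace_eq hb0 ha0 (hmem.hasType hS0) (hmem'.hasType hR0)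
    (ρ := max ρ ρ') (fun ζ hζ => ?_) ⟨htb, ht⟩
  rw [hρ ζ ((le_max_left _ _).trans_lt hζ), hρ' ζ ((le_max_right _ _).trans_lt hζ)]

/-! ### The principal branch of the hypergeometric function -/

lemma mem_cutPlane_iff {z : ℂ} : z ∈ cutPlane ↔ 1 - z ∈ slitPlane := by
  simp only [cutPlane, mem_ofPred_eq, mem_slitPlane_iff, sub_re, one_re, sub_im, one_im, zero_sub,
    neg_ne_zero, sub_pos]
  constructor
  · intro h
    by_contra! h'
    exact h ⟨h'.1, h'.2⟩
  · rintro (h | h) ⟨h1, h2⟩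
    · linarith
    · exact h h2

lemma isOpen_cutPlane : IsOpen cutPlane := by
  have : cutPlane = (fun z : ℂ => 1 - z) ⁻¹' slitPlane := Set.ext fun _ => mem_cutPlane_iff
  rw [this]
  exact isOpen_slitPlane.preimage (by fun_prop)

lemma ball_subset_cutPlane : Metric.ball (0 : ℂ) 1 ⊆ cutPlane := by
  rintro z hz ⟨h1, -⟩
  have : ‖z‖ < 1 := by simpa using hz
  linarith [re_le_norm z]

lemma zero_mem_cutPlane : (0 : ℂ) ∈ cutPlane := ball_subset_cutPlane (by simp)

lemma isPreconnected_cutPlane : IsPreconnected cutPlane := by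
  refine (StarConvex.isPathConnected (a := (0 : ℂ)) ?_
    zero_mem_cutPlane).isConnected.isPreconnected
  rw [starConvex_zero_iff]
  rintro z hz s hs0 hs1 ⟨h1, h2⟩
  rw [real_smul, re_ofReal_mul] at h1
  rw [real_smul, im_ofReal_mul] at h2
  rcases mul_eq_zero.1 h2 with h | h
  · rw [h, zero_mul] at h1; linarith
  · refine hz ⟨?_, h⟩
    by_contra! hlt
    rcases le_or_gt z.re 0 with h0 | h0 <;> nlinarith

/-- The Taylor coefficients `Γ(α+n+1)/n!` of `Γ(α+1)(1-z)^{-α-1}`, which are also the multipliers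
of the fractional derivative of order `α`. -/
def mult (α : ℂ) (n : ℕ) : ℂ := Gamma (α + n + 1) / n.factorial

/-- The function `z^{-k} (Γ(α+1)(1-z)^{-α-1} - ∑_{n<k} Γ(α+n+1)/n! z^n)` on the cut plane, with its
removable singularity at `0` filled in. -/
def tail (α : ℂ) : ℕ → ℂ → ℂ
  | 0 => fun z => Gamma (α + 1) * (1 - z) ^ (-(α + 1))
  | k + 1 => dslope (tail α k) 0

lemma mult_ne_zero {α : ℂ} (hα : -1 < α.re) (n : ℕ) : mult α n ≠ 0 :=
  div_ne_zero (Gamma_ne_zero_of_re_pos (by simp; linarith [n.cast_nonneg (α := ℝ)]))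
    (by exact_mod_cast n.factorial_ne_zero)

lemma differentiableOn_tail (α : ℂ) (k : ℕ) : DifferentiableOn ℂ (tail α k) cutPlane := by
  induction k with
  | zero =>
    intro z hz
    have h : DifferentiableAt ℂ (fun z : ℂ => 1 - z) z := by fun_prop
    exact ((h.cpow_const (mem_cutPlane_iff.1 hz)).const_mul _).differentiableWithinAt
  | succ k ih =>
    exact (differentiableOn_dslope (isOpen_cutPlane.mem_nhds zero_mem_cutPlane)).2 ih

lemma ascPochhammer_eval_mul_Gamma {s : ℂ} (hs : 0 < s.re) (n : ℕ) :
    (ascPochhammer ℂ n).eval s * Gamma s = Gamma (s + n) := by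
  induction n with
  | zero => simp
  | succ n ih =>
    have h : s + n ≠ 0 := fun h => by
      have := congrArg re h
      simp at this
      linarith [n.cast_nonneg (α := ℝ)]
    rw [ascPochhammer_succ_eval, Nat.cast_succ, ← add_assoc, Gamma_add_one _ h, ← ih]
    ring

lemma HasTaylor.dslope {a : ℝ} (ha : 0 < a) {u : ℕ → ℂ} {f : ℂ → ℂ} (hf : HasTaylor a u f) :
    HasTaylor a (fun n => u (n + 1)) (dslope f 0) := by
  have h0 : f 0 = u 0 := by
    refine (hf 0 (by simpa)).unique ?_
    simpa using hasSum_single (f := fun n => u n * (0 : ℂ) ^ n) 0 (fun n hn => by simp [hn])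
  intro z hz
  rcases eq_or_ne z 0 with rfl | hz0
  · rw [dslope_same]
    have h1 := (hf.hasSum_deriv hz).unique (hasSum_single 1 fun n hn => by
      rcases n with _ | n
      · simp
      · have : n ≠ 0 := fun h => hn (by simp [h])
        simp [this])
    rw [h1]
    simpa using hasSum_single (f := fun n => u (n + 1) * (0 : ℂ) ^ n) 0 (fun n hn => by simp [hn])
  · rw [dslope_of_ne _ hz0, slope_def_field, sub_zero, h0]
    have := ((hasSum_nat_add_iff' 1).2 (hf z hz)).div_const z
    simp only [Finset.range_one, Finset.sum_singleton, pow_zero, mul_one] at this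
    refine this.congr_fun fun n => ?_
    rw [pow_succ, ← mul_assoc, mul_div_cancel_right₀ _ hz0]

lemma hasTaylor_tail {α : ℂ} (hα : -1 < α.re) (k : ℕ) :
    HasTaylor 1 (fun n => mult α (n + k)) (tail α k) := by
  induction k with
  | zero =>
    intro z hz
    have h := (one_div_one_sub_cpow_hasFPowerSeriesOnBall_zero (α + 1)).hasSum (y := z)
      (by simpa [enorm_eq_nnnorm, ← NNReal.coe_lt_one] using hz)
    have h2 := h.mul_left (Gamma (α + 1))
    simp only [zero_add] at h2
    rw [one_div, ← cpow_neg] at h2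
    refine h2.congr_fun fun n => ?_
    change mult α n * z ^ n = _
    rw [FormalMultilinearSeries.ofScalars_apply_eq, Ring.choose_eq_smul,
      Polynomial.descPochhammer_smeval_eq_ascPochhammer, Polynomial.ascPochhammer_smeval_cast,
      Polynomial.ascPochhammer_smeval_eq_eval, show α + 1 + n - 1 - n + 1 = α + 1 by ring, mult,
      show α + n + 1 = α + 1 + n by ring,
      ← ascPochhammer_eval_mul_Gamma (by simp; linarith)]
    simp only [smul_eq_mul]
    ring
  | succ k ih =>
    simpa [tail, add_right_comm, add_assoc] using ih.dslope zero_lt_one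

lemma tail_zero {α : ℂ} (hα : -1 < α.re) (k : ℕ) : tail α k 0 = mult α k := by
  refine (hasTaylor_tail hα k 0 (by simp)).unique ?_
  simpa using hasSum_single (f := fun n => mult α (n + k) * (0 : ℂ) ^ n) 0
    (fun n hn => by simp [hn])

lemma exists_mult_bound {α : ℂ} (hα : -1 < α.re) :
    ∃ C, 0 ≤ C ∧ ∀ n, ‖mult α n‖ ≤ C * (3 / 2) ^ n := by
  have hs := (hasTaylor_tail hα 0).summable_norm (ρ := 2 / 3) (by norm_num) (by norm_num)
  refine ⟨∑' n, ‖mult α (n + 0)‖ * (2 / 3) ^ n, tsum_nonneg fun n => by positivity, fun n => ?_⟩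
  have := hs.le_tsum n fun j _ => by positivity
  calc ‖mult α n‖ = (‖mult α (n + 0)‖ * (2 / 3) ^ n) * (3 / 2) ^ n := by
        rw [mul_assoc, ← mul_pow]; norm_num
    _ ≤ _ := by gcongr

/-- The functions `tail α k` grow at most like `2^k`, uniformly where `tail α 0` is bounded. -/
lemma exists_tail_bound {α : ℂ} (hα : -1 < α.re) :
    ∃ C, 0 ≤ C ∧ ∀ k : ℕ, ∀ z : ℂ, ‖tail α k z‖ ≤ 2 ^ k * (‖tail α 0 z‖ + C) := by
  obtain ⟨C, hC0, hC⟩ := exists_mult_bound hα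
  refine ⟨4 * C, by positivity, fun k z => ?_⟩
  rcases le_or_gt ‖z‖ (1 / 2) with hz | hz
  · have h1 := hasTaylor_tail hα k z (by simp; linarith)
    have hg : HasSum (fun n : ℕ => C * (3 / 2) ^ k * (3 / 4 : ℝ) ^ n) (C * (3 / 2) ^ k * 4) := by
      have := (hasSum_geometric_of_lt_one (r := (3 / 4 : ℝ)) (by norm_num)
        (by norm_num)).mul_left (C * (3 / 2) ^ k)
      norm_num at this ⊢
      exact this
    have h2 : ‖tail α k z‖ ≤ C * (3 / 2) ^ k * 4 := by
      rw [← h1.tsum_eq]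
      refine tsum_of_norm_bounded hg fun n => ?_
      rw [norm_mul, norm_pow]
      calc ‖mult α (n + k)‖ * ‖z‖ ^ n ≤ (C * (3 / 2) ^ (n + k)) * (1 / 2) ^ n := by
            gcongr
            exact hC _
        _ = C * (3 / 2) ^ k * ((3 / 2) * (1 / 2)) ^ n := by rw [mul_pow, pow_add]; ring
        _ = _ := by norm_num
    calc ‖tail α k z‖ ≤ C * (3 / 2) ^ k * 4 := h2
      _ ≤ C * 2 ^ k * 4 := by gcongr; norm_num
      _ ≤ _ := by nlinarith [norm_nonneg (tail α 0 z), pow_pos (zero_lt_two (α := ℝ)) k]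
  · have hz0 : z ≠ 0 := norm_pos_iff.1 (by linarith)
    have key : ‖tail α k z‖ ≤
        2 ^ k * (‖tail α 0 z‖ + C * ∑ j ∈ Finset.range k, (3 / 4 : ℝ) ^ j) := by
      induction k with
      | zero => simp
      | succ k ih =>
        have h1 : ‖tail α (k + 1) z‖ ≤ 2 * (‖tail α k z‖ + ‖mult α k‖) := by
          rw [tail, dslope_of_ne _ hz0, slope_def_field, sub_zero, tail_zero hα, norm_div,
            div_le_iff₀ (by linarith)]
          have := norm_sub_le (tail α k z) (mult α k)
          nlinarith [norm_nonneg (tail α k z), norm_nonneg (mult α k)]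
        have h2 : (3 / 2 : ℝ) ^ k = 2 ^ k * (3 / 4) ^ k := by rw [← mul_pow]; norm_num
        calc ‖tail α (k + 1) z‖ ≤ 2 * (‖tail α k z‖ + ‖mult α k‖) := h1
          _ ≤ 2 * (2 ^ k * (‖tail α 0 z‖ + C * ∑ j ∈ Finset.range k, (3 / 4 : ℝ) ^ j) +
              C * (3 / 2) ^ k) := by gcongr; exact hC k
          _ = _ := by rw [Finset.sum_range_succ, h2]; ring
    refine key.trans ?_
    have h4 : ∑ j ∈ Finset.range k, (3 / 4 : ℝ) ^ j ≤ 4 := by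
      have := (summable_geometric_of_lt_one (r := (3 / 4 : ℝ)) (by norm_num)
        (by norm_num)).sum_le_tsum (Finset.range k) (fun j _ => by positivity)
      rw [tsum_geometric_of_lt_one (by norm_num) (by norm_num)] at this
      linarith
    rw [mul_comm 4 C]
    gcongr

lemma mult_add {α : ℂ} (hα : -1 < α.re) (k n : ℕ) :
    mult α (n + k) = mult α k *
      ordinaryHypergeometricCoefficient (α + k + 1) 1 ((k : ℂ) + 1) n := by
  have h1 : 0 < (α + k + 1).re := by simp; linarith [k.cast_nonneg (α := ℝ)]
  have h2 : 0 < ((k : ℂ) + 1).re := by simp; linarith [k.cast_nonneg (α := ℝ)]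
  have e1 := ascPochhammer_eval_mul_Gamma h1 n
  have e2 := ascPochhammer_eval_mul_Gamma h2 n
  rw [show (k : ℂ) + 1 + n = ((n + k : ℕ) : ℂ) + 1 by push_cast; ring, Gamma_nat_eq_factorial,
    Gamma_nat_eq_factorial] at e2
  have f1 : ((n + k).factorial : ℂ) ≠ 0 := by exact_mod_cast (n + k).factorial_ne_zero
  have f2 : (k.factorial : ℂ) ≠ 0 := by exact_mod_cast k.factorial_ne_zero
  have f3 : (n.factorial : ℂ) ≠ 0 := by exact_mod_cast n.factorial_ne_zero
  have e3 : (ascPochhammer ℂ n).eval ((k : ℂ) + 1) = (n + k).factorial / k.factorial := by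
    rw [← e2]; field_simp
  rw [mult, mult, ordinaryHypergeometricCoefficient, e3, ascPochhammer_eval_one,
    show α + (n + k : ℕ) + 1 = α + k + 1 + n by push_cast; ring, ← e1]
  field_simp

/-- On the cut plane `Γ(α+k+1)/k! · ₂F₁(α+k+1, 1; k+1; z)` is the `k`-th tail of the Taylor series
of `Γ(α+1)(1-z)^{-α-1}`, divided by `z^k`. -/
lemma mult_mul_gauss2F1 {α : ℂ} (hα : -1 < α.re) (k : ℕ) {z : ℂ} (hz : z ∈ cutPlane) :
    mult α k * gauss2F1 (α + k + 1) 1 (k + 1) z = tail α k z := by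
  have hm := mult_ne_zero hα k
  have hbr : IsGaussBranch (α + k + 1) 1 (k + 1) fun z => tail α k z / mult α k := by
    refine ⟨((differentiableOn_tail α k).div_const _).analyticOnNhd isOpen_cutPlane,
      fun w hw => ?_⟩
    rw [ordinaryHypergeometric_eq_tsum]
    simp only [smul_eq_mul]
    rw [← (hasTaylor_tail hα k w hw).tsum_eq, div_eq_iff hm, mul_comm _ (mult α k),
      ← tsum_mul_left]
    refine tsum_congr fun n => ?_
    simp only [mult_add hα]
    ring
  have hex : ∃ G : ℂ → ℂ, IsGaussBranch (α + k + 1) 1 (k + 1) G := ⟨_, hbr⟩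
  have heq : EqOn hex.choose (fun z => tail α k z / mult α k) cutPlane := by
    refine AnalyticOnNhd.eqOn_of_preconnected_of_eventuallyEq hex.choose_spec.1 hbr.1
      isPreconnected_cutPlane zero_mem_cutPlane ?_
    filter_upwards [Metric.ball_mem_nhds (0 : ℂ) zero_lt_one] with w hw
    exact (hex.choose_spec.2 w hw).trans (hbr.2 w hw).symm
  rw [gauss2F1, dif_pos hex, heq hz]
  exact mul_div_cancel₀ _ hm

/-! ### Contour integrals over `γ(A)` -/

/-- Parameter domains of the upper ray, the half circle and the lower ray. -/
def pieceSet : Fin 3 → Set ℝ := ![Ioi 0, Ioc (Real.pi / 2) (3 * Real.pi / 2), Ioi 0]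

/-- Parametrizations of the upper ray, the half circle and the lower ray. -/
def pieceMap (A : ℝ) : Fin 3 → ℝ → ℂ :=
  ![fun x => x + A * I, fun θ => A * exp (θ * I), fun x => x - A * I]

/-- The factors by which `dξ` differs from the parameter differential on the pieces of `γ(A)`; the
upper ray is run through backwards. -/
def pieceWeight (A : ℝ) : Fin 3 → ℝ → ℂ :=
  ![fun _ => -1, fun θ => A * I * exp (θ * I), fun _ => 1]

lemma contourIntegral_eq_sum (A : ℝ) (g : ℂ → ℂ) :
    contourIntegral A g =
      ∑ i, ∫ x in pieceSet i, pieceWeight A i x * g (pieceMap A i x) := by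
  have h : Real.pi / 2 ≤ 3 * Real.pi / 2 := by linarith [Real.pi_pos]
  simp only [contourIntegral, Fin.sum_univ_three, pieceSet, pieceMap, pieceWeight,
    Matrix.cons_val_zero, Matrix.cons_val_one, Matrix.cons_val, neg_one_mul, one_mul,
    integral_neg, intervalIntegral.integral_of_le h]
  congr 3
  ext θ
  ring

lemma measurableSet_pieceSet (i : Fin 3) : MeasurableSet (pieceSet i) := by
  fin_cases i
  exacts [measurableSet_Ioi, measurableSet_Ioc, measurableSet_Ioi]

lemma continuous_pieceWeight (A : ℝ) (i : Fin 3) : Continuous (pieceWeight A i) := by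
  fin_cases i <;> simp [pieceWeight] <;> fun_prop

lemma pieceMap_mem_bdry {A : ℝ} (hA : 0 ≤ A) {i : Fin 3} {x : ℝ} (hx : x ∈ pieceSet i) :
    pieceMap A i x ∈ bdry A := by
  fin_cases i
  · exact upper_mem_bdry hA (le_of_lt hx)
  · exact arc_mem_bdry hA (Ioc_subset_Icc_self hx)
  · exact lower_mem_bdry hA (le_of_lt hx)

lemma integrableOn_piece {A C δ : ℝ} (hA : 0 ≤ A) (hδ : 0 < δ) {g : ℂ → ℂ}
    (hg : ContinuousOn g (bdry A)) (hb : ∀ ξ ∈ bdry A, ‖g ξ‖ ≤ C * Real.exp (-δ * ‖ξ‖))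
    (i : Fin 3) : IntegrableOn (fun x => pieceWeight A i x * g (pieceMap A i x)) (pieceSet i) := by
  obtain ⟨h1, h2, h3⟩ := absConvergent_of_bound hA hδ hg hb
  have hW : ∃ K, ∀ x, ‖pieceWeight A i x‖ ≤ K := by
    fin_cases i
    · exact ⟨1, fun x => by simp [pieceWeight]⟩
    · exact ⟨|A|, fun x => by simp [pieceWeight, norm_exp_ofReal_mul_I]⟩
    · exact ⟨1, fun x => by simp [pieceWeight]⟩
  obtain ⟨K, hK⟩ := hW
  refine Integrable.bdd_mul (c := K) ?_ (continuous_pieceWeight A i).aestronglyMeasurable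
    (Eventually.of_forall hK)
  fin_cases i
  · exact h1
  · exact h2.mono_set Ioc_subset_Icc_self
  · exact h3

/-- Integrable majorants on the three pieces. -/
lemma integrableOn_piece_exp {A δ : ℝ} (hA : 0 ≤ A) (hδ : 0 < δ) (i : Fin 3) :
    IntegrableOn (fun x => ‖pieceWeight A i x‖ * Real.exp (-δ * ‖pieceMap A i x‖))
      (pieceSet i) := by
  have := (integrableOn_piece hA hδ (C := 1) (g := fun ξ => (Real.exp (-δ * ‖ξ‖) : ℂ))
    (by fun_prop) (fun ξ _ => by
      rw [norm_real, Real.norm_of_nonneg (Real.exp_pos _).le, one_mul]) i).norm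
  refine this.congr (Eventually.of_forall fun x => ?_)
  simp only
  rw [norm_mul, norm_real, Real.norm_of_nonneg (Real.exp_pos _).le]

lemma contourIntegral_congr {A : ℝ} (hA : 0 ≤ A) {f g : ℂ → ℂ} (h : EqOn f g (bdry A)) :
    contourIntegral A f = contourIntegral A g := by
  rw [contourIntegral_eq_sum, contourIntegral_eq_sum]
  refine Finset.sum_congr rfl fun i _ => ?_
  refine setIntegral_congr_fun (measurableSet_pieceSet i) fun x hx => ?_
  rw [h (pieceMap_mem_bdry hA hx)]

lemma contourIntegral_const_mul (A : ℝ) (c : ℂ) (g : ℂ → ℂ) :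
    contourIntegral A (fun ξ => c * g ξ) = c * contourIntegral A g := by
  rw [contourIntegral_eq_sum, contourIntegral_eq_sum, Finset.mul_sum]
  refine Finset.sum_congr rfl fun i _ => ?_
  rw [← integral_const_mul]
  congr 1
  ext x
  ring

lemma exists_contourIntegral_bound {A δ : ℝ} (hA : 0 ≤ A) (hδ : 0 < δ) :
    ∃ L, 0 ≤ L ∧ ∀ (C : ℝ) (g : ℂ → ℂ), (∀ ξ ∈ bdry A, ‖g ξ‖ ≤ C * Real.exp (-δ * ‖ξ‖)) →
      ‖contourIntegral A g‖ ≤ C * L := by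
  refine ⟨∑ i, ∫ x in pieceSet i, ‖pieceWeight A i x‖ * Real.exp (-δ * ‖pieceMap A i x‖),
    Finset.sum_nonneg fun i _ => integral_nonneg fun x => by positivity, fun C g hg => ?_⟩
  rw [contourIntegral_eq_sum, Finset.mul_sum]
  refine (norm_sum_le _ _).trans (Finset.sum_le_sum fun i _ => ?_)
  rw [← integral_const_mul]
  refine norm_integral_le_of_norm_le ((integrableOn_piece_exp hA hδ i).const_mul C)
    ((ae_restrict_iff' (measurableSet_pieceSet i)).2 (Eventually.of_forall fun x hx => ?_))
  rw [norm_mul]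
  calc ‖pieceWeight A i x‖ * ‖g (pieceMap A i x)‖
      ≤ ‖pieceWeight A i x‖ * (C * Real.exp (-δ * ‖pieceMap A i x‖)) := by
        gcongr
        exact hg _ (pieceMap_mem_bdry hA hx)
    _ = _ := by ring

lemma hasSum_contourIntegral {A δ : ℝ} (hA : 0 ≤ A) (hδ : 0 < δ) {f : ℕ → ℂ → ℂ} {g : ℂ → ℂ}
    {v : ℕ → ℝ} (hv : Summable v) (hf : ∀ n, ContinuousOn (f n) (bdry A))
    (hb : ∀ n, ∀ ξ ∈ bdry A, ‖f n ξ‖ ≤ v n * Real.exp (-δ * ‖ξ‖))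
    (hs : ∀ ξ ∈ bdry A, HasSum (fun n => f n ξ) (g ξ)) :
    HasSum (fun n => contourIntegral A (f n)) (contourIntegral A g) := by
  simp only [contourIntegral_eq_sum]
  refine hasSum_sum fun i _ => ?_
  have h := hasSum_integral_of_summable_integral_norm (μ := volume.restrict (pieceSet i))
    (F := fun n x => pieceWeight A i x * f n (pieceMap A i x))
    (fun n => integrableOn_piece hA hδ (hf n) (hb n) i) (by
      refine Summable.of_nonneg_of_le (fun n => integral_nonneg fun x => norm_nonneg _)
        (fun n => ?_) (hv.mul_right (∫ x in pieceSet i,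
          ‖pieceWeight A i x‖ * Real.exp (-δ * ‖pieceMap A i x‖)))
      rw [← integral_const_mul]
      refine integral_mono_ae (integrableOn_piece hA hδ (hf n) (hb n) i).norm
        ((integrableOn_piece_exp hA hδ i).const_mul _)
        ((ae_restrict_iff' (measurableSet_pieceSet i)).2 (Eventually.of_forall fun x hx => ?_))
      simp only
      rw [norm_mul]
      calc ‖pieceWeight A i x‖ * ‖f n (pieceMap A i x)‖
          ≤ ‖pieceWeight A i x‖ * (v n * Real.exp (-δ * ‖pieceMap A i x‖)) := by
            gcongr
            exact hb n _ (pieceMap_mem_bdry hA hx)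
        _ = _ := by ring)
  have heq : ∫ x in pieceSet i, ∑' n, pieceWeight A i x * f n (pieceMap A i x) =
      ∫ x in pieceSet i, pieceWeight A i x * g (pieceMap A i x) :=
    setIntegral_congr_fun (measurableSet_pieceSet i) fun x hx => by
      simp only [tsum_mul_left, (hs _ (pieceMap_mem_bdry hA hx)).tsum_eq]
  rwa [heq] at h

lemma differentiableOn_contourIntegral {A C δ : ℝ} (hA : 0 ≤ A) (hδ : 0 < δ) {U : Set ℂ}
    (hU : IsOpen U) {f : ℂ → ℂ → ℂ} (hf : ∀ t ∈ U, ContinuousOn (f t) (bdry A))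
    (hd : ∀ ξ ∈ bdry A, DifferentiableOn ℂ (fun t => f t ξ) U)
    (hb : ∀ t ∈ U, ∀ ξ ∈ bdry A, ‖f t ξ‖ ≤ C * Real.exp (-δ * ‖ξ‖)) :
    DifferentiableOn ℂ (fun t => contourIntegral A (f t)) U := by
  simp only [contourIntegral_eq_sum]
  refine DifferentiableOn.fun_sum fun i _ t ht => ?_
  refine (hasDerivAt_integral_of_holomorphic hU
    (f := fun t x => pieceWeight A i x * f t (pieceMap A i x))
    (fun t ht => (integrableOn_piece hA hδ (hf t ht) (hb t ht) i).aestronglyMeasurable)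
    ((ae_restrict_iff' (measurableSet_pieceSet i)).2 (Eventually.of_forall fun x hx =>
      (hd _ (pieceMap_mem_bdry hA hx)).const_mul _)) ht zero_lt_one
    ((integrableOn_piece_exp hA hδ i).const_mul C)
    ((ae_restrict_iff' (measurableSet_pieceSet i)).2 (Eventually.of_forall fun x hx s hs => ?_))
    ).differentiableAt.differentiableWithinAt
  rw [norm_mul]
  calc ‖pieceWeight A i x‖ * ‖f s (pieceMap A i x)‖
      ≤ ‖pieceWeight A i x‖ * (C * Real.exp (-δ * ‖pieceMap A i x‖)) := by
        gcongr
        exact hb s hs.1 _ (pieceMap_mem_bdry hA hx)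
    _ = _ := by ring

/-! ### Deformation of `γ(A)` to the circle -/

lemma starConvex_region_inter_slitPlane {a : ℝ} (ha : 0 < a) :
    StarConvex ℝ (1 : ℂ) (region a ∩ slitPlane) := by
  refine StarConvex.inter ((convex_region a).starConvex ?_) starConvex_one_slitPlane
  simpa using ofReal_mem_region ha zero_le_one

/-- For a function analytic in `𝔇(a)` except at `0` and exponentially decreasing at infinity, the
contour `γ(A)` may be replaced by the circle `|ξ| = A`: the two have the left half circle in
common, and elsewhere a primitive exists off the negative half-line. -/
lemma contourIntegral_eq_circleIntegral {a A C δ : ℝ} (hA : 0 < A) (hAa : A < a) (hδ : 0 < δ)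
    {g : ℂ → ℂ} (hg : DifferentiableOn ℂ g (region a \ {0}))
    (hb : ∀ ξ ∈ region a, A ≤ ‖ξ‖ → ‖g ξ‖ ≤ C * Real.exp (-δ * ‖ξ‖)) :
    contourIntegral A g = ∮ z in C(0, A), g z := by
  have ha : 0 < a := hA.trans hAa
  have hC : 0 ≤ C := by
    have h1 := hb _ (bdry_subset_region hAa (upper_mem_bdry hA.le le_rfl))
      (le_norm_of_mem_bdry (upper_mem_bdry hA.le le_rfl))
    exact nonneg_of_mul_nonneg_left ((norm_nonneg _).trans h1) (Real.exp_pos _)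
  have hbR : bdry A ⊆ region a \ {0} := fun ξ hξ =>
    ⟨bdry_subset_region hAa hξ, ne_zero_of_mem_bdry hA hξ⟩
  obtain ⟨h1, -, h3⟩ := absConvergent_of_bound hA.le hδ (hg.continuousOn.mono hbR)
    fun ξ hξ => hb ξ (hbR hξ).1 (le_norm_of_mem_bdry hξ)
  set U := region a ∩ slitPlane with hU
  have hUo : IsOpen U := (isOpen_region a).inter isOpen_slitPlane
  have hgU : DifferentiableOn ℂ g U := hg.mono fun z hz => ⟨hz.1, slitPlane_ne_zero hz.2⟩
  obtain ⟨P, hP⟩ := exists_primitive_of_starConvex hUo (starConvex_region_inter_slitPlane ha) hgU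
  have hAI : ∀ x : ℝ, 0 ≤ x → ∀ y : ℝ, |y| ≤ A → (x ≠ 0 ∨ y ≠ 0) → (x + y * I : ℂ) ∈ U := by
    intro x hx y hy hxy
    refine ⟨?_, ?_⟩
    · change Metric.infDist _ _ < a
      rw [infDist_ray_of_nonneg (by simpa)]
      simpa using hy.trans_lt hAa
    · rw [mem_slitPlane_iff]
      rcases hxy with h | h
      · left; simpa using lt_of_le_of_ne hx h.symm
      · right; simpa using h
  -- integrals along the rays
  have hray : ∀ y : ℝ, |y| = A → ∀ X : ℝ, 0 ≤ X →
      ∫ x in (0 : ℝ)..X, g (x + y * I) = P (X + y * I) - P (y * I) := by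
    intro y hy X hX
    have hy0 : y ≠ 0 := fun h => by simp [h] at hy; linarith
    have hmem : ∀ x ∈ uIcc 0 X, (x + y * I : ℂ) ∈ U := fun x hx => by
      rw [uIcc_of_le hX] at hx
      exact hAI x hx.1 y hy.le (Or.inr hy0)
    have := intervalIntegral.integral_eq_sub_of_hasDerivAt
      (f := fun x : ℝ => P (x + y * I)) (f' := fun x : ℝ => g (x + y * I)) (a := 0) (b := X)
      (fun x hx => by
        have e : HasDerivAt (fun x : ℝ => (x : ℂ) + y * I) 1 x :=
          (ofRealCLM.hasDerivAt (x := x)).add_const _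
        exact ((hP _ (hmem x hx)).comp x e).congr_deriv (mul_one _))
      (ContinuousOn.intervalIntegrable (hgU.continuousOn.comp (by fun_prop) hmem))
    simpa using this
  have hlim1 : Tendsto (fun X : ℝ => P (X + A * I) - P (A * I)) atTop
      (𝓝 (∫ x in Ioi (0 : ℝ), g (x + A * I))) := by
    refine (intervalIntegral_tendsto_integral_Ioi 0 h1 tendsto_id).congr' ?_
    filter_upwards [eventually_ge_atTop 0] with X hX
    exact hray A (abs_of_pos hA) X hX
  have hlim2 : Tendsto (fun X : ℝ => P (X - A * I) - P (-(A * I))) atTop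
      (𝓝 (∫ x in Ioi (0 : ℝ), g (x - A * I))) := by
    refine (intervalIntegral_tendsto_integral_Ioi 0 h3 tendsto_id).congr' ?_
    filter_upwards [eventually_ge_atTop 0] with X hX
    simpa [sub_eq_add_neg] using hray (-A) (by rw [abs_neg, abs_of_pos hA]) X hX
  have hlim3 : Tendsto (fun X : ℝ => P (X + A * I) - P (X - A * I)) atTop (𝓝 0) := by
    have hz : Tendsto (fun X : ℝ => C * Real.exp (-δ * X) * (2 * A)) atTop (𝓝 0) := by
      have : Tendsto (fun X : ℝ => -δ * X) atTop atBot :=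
        tendsto_id.const_mul_atTop_of_neg (by linarith)
      simpa using ((Real.tendsto_exp_atBot.comp this).const_mul C).mul_const (2 * A)
    refine squeeze_zero_norm' ?_ hz
    filter_upwards [eventually_ge_atTop A] with X hX
    have hX0 : 0 < X := hA.trans_le hX
    have hseg : ∀ z ∈ segment ℝ (X - A * I : ℂ) (X + A * I), ∃ y : ℝ, |y| ≤ A ∧ z = X + y * I := by
      intro z hz
      have hconv : Convex ℝ ({z : ℂ | z.re = X} ∩ {z : ℂ | -A ≤ z.im ∧ z.im ≤ A}) :=
        ((convex_hyperplane (IsLinearMap.mk add_re fun c x => by simp) X)).inter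
          ((convex_halfSpace_im_ge (-A)).inter (convex_halfSpace_im_le A))
      have hz' := hconv.segment_subset (x := (X - A * I : ℂ)) (y := (X + A * I : ℂ))
        ⟨by simp, by simp; linarith⟩ ⟨by simp, by simp; linarith⟩ hz
      exact ⟨z.im, abs_le.2 hz'.2, Complex.ext (by simpa using hz'.1) (by simp)⟩
    have hmv := Convex.norm_image_sub_le_of_norm_hasDerivWithin_le (f := P) (f' := g)
      (C := C * Real.exp (-δ * X))
      (fun z hz => by
        obtain ⟨y, hy, rfl⟩ := hseg z hz
        exact (hP _ (hAI X hX0.le y hy (Or.inl hX0.ne'))).hasDerivWithinAt)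
      (fun z hz => by
        obtain ⟨y, hy, rfl⟩ := hseg z hz
        have hn : X ≤ ‖(X + y * I : ℂ)‖ := le_norm_upper y hX0
        refine (hb _ (hAI X hX0.le y hy (Or.inl hX0.ne')).1 (hX.trans hn)).trans ?_
        gcongr C * Real.exp ?_
        nlinarith)
      (convex_segment (X - A * I : ℂ) (X + A * I))
      (left_mem_segment ℝ _ _) (right_mem_segment ℝ _ _)
    refine hmv.trans_eq ?_
    congr 1
    rw [show (X + A * I : ℂ) - (X - A * I) = ((2 * A : ℝ) : ℂ) * I by push_cast; ring, norm_mul,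
      norm_real, norm_I, mul_one, Real.norm_of_nonneg (by linarith)]
  have hrays : -(∫ x in Ioi (0 : ℝ), g (x + A * I)) + (∫ x in Ioi (0 : ℝ), g (x - A * I)) =
      P (A * I) - P (-(A * I)) := by
    refine tendsto_nhds_unique (hlim1.neg.add hlim2) ?_
    have := hlim3.neg.add_const (P (A * I) - P (-(A * I)))
    rw [neg_zero, zero_add] at this
    refine this.congr fun X => ?_
    ring
  -- the right half circle
  set q : ℝ → ℂ := fun θ => g (A * exp (θ * I)) * (A * I * exp (θ * I)) with hq
  have hqc : Continuous q := by
    refine Continuous.mul ?_ (by fun_prop)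
    refine continuousOn_univ.1 (hg.continuousOn.comp (by fun_prop) fun θ _ => ⟨?_, ?_⟩)
    · refine ball_subset_region a ?_
      simpa [norm_exp_ofReal_mul_I, abs_of_pos hA] using hAa
    · simp [hA.ne', exp_ne_zero]
  have hright : ∫ θ in (-(Real.pi / 2))..(Real.pi / 2), q θ = P (A * I) - P (-(A * I)) := by
    have := intervalIntegral.integral_eq_sub_of_hasDerivAt
      (f := fun θ : ℝ => P (A * exp (θ * I))) (f' := q) (a := -(Real.pi / 2)) (b := Real.pi / 2)
      (fun θ hθ => by
        rw [uIcc_of_le (by linarith [Real.pi_pos])] at hθ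
        have hmem : (A * exp (θ * I) : ℂ) ∈ U := by
          have e : (A * exp (θ * I) : ℂ) =
              ((A * Real.cos θ : ℝ) : ℂ) + ((A * Real.sin θ : ℝ) : ℂ) * I := by
            rw [exp_mul_I]; push_cast; ring
          rw [e]
          refine hAI _ (mul_nonneg hA.le (Real.cos_nonneg_of_mem_Icc hθ)) _ ?_ ?_
          · rw [abs_mul, abs_of_pos hA]
            exact mul_le_of_le_one_right hA.le (Real.abs_sin_le_one θ)
          · by_contra! h
            have h1 := (mul_eq_zero.1 h.1).resolve_left hA.ne'
            have h2 := (mul_eq_zero.1 h.2).resolve_left hA.ne'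
            have := Real.sin_sq_add_cos_sq θ
            rw [h1, h2] at this
            norm_num at this
        have e : HasDerivAt (fun θ : ℝ => (A : ℂ) * exp (θ * I))
            (A * (exp (θ * I) * (1 * I))) θ :=
          (((ofRealCLM.hasDerivAt (x := θ)).mul_const I).cexp).const_mul _
        refine ((hP _ hmem).comp θ e).congr_deriv ?_
        simp only [hq]
        ring)
      (hqc.intervalIntegrable _ _)
    rw [this]
    congr 2
    · congr 1
      push_cast
      rw [exp_pi_div_two_mul_I]
    · push_cast
      rw [neg_mul, exp_neg, exp_pi_div_two_mul_I, inv_I]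
      ring
  have hper : Function.Periodic q (2 * Real.pi) := by
    intro θ
    simp only [hq]
    have : exp ((θ + 2 * Real.pi : ℝ) * I) = exp (θ * I) := by
      push_cast
      rw [add_mul, Complex.exp_add, exp_two_pi_mul_I, mul_one]
    rw [this]
  have hcirc : (∮ z in C(0, A), g z) = ∫ θ in (0 : ℝ)..2 * Real.pi, q θ := by
    simp only [circleIntegral, deriv_circleMap, circleMap_zero, smul_eq_mul, hq]
    refine intervalIntegral.integral_congr fun θ _ => ?_
    ring
  have hshift := hper.intervalIntegral_add_eq 0 (-(Real.pi / 2))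
  rw [zero_add, show -(Real.pi / 2) + 2 * Real.pi = 3 * Real.pi / 2 by ring] at hshift
  rw [hcirc, hshift, ← intervalIntegral.integral_add_adjacent_intervals
    (hqc.intervalIntegrable _ (Real.pi / 2)) (hqc.intervalIntegrable _ _), hright, ← hrays,
    contourIntegral]
  ring

/-- Cauchy's formula for Taylor coefficients, over the contour `γ(A)`. -/
lemma hasTaylor_contourIntegral {a A C δ : ℝ} (hA : 0 < A) (hAa : A < a) (hδ : 0 < δ)
    {h : ℂ → ℂ} (hh : DifferentiableOn ℂ h (region a))
    (hb : ∀ ξ ∈ region a, ‖h ξ‖ ≤ C * Real.exp (-δ * ‖ξ‖)) :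
    HasTaylor A (fun n => 1 / (2 * Real.pi * I) *
      contourIntegral A (fun ξ => h ξ / ξ ^ (n + 1))) h := by
  have hcb : Metric.closedBall (0 : ℂ) A ⊆ region a :=
    (Metric.closedBall_subset_ball hAa).trans (ball_subset_region a)
  intro t ht
  lift A to NNReal using hA.le
  have hps := DifferentiableOn.hasFPowerSeriesOnBall (R := A) (c := (0 : ℂ))
    (hh.mono hcb) hA
  have hsum := hps.hasSum (y := t) (by
    simpa [enorm_eq_nnnorm, ← NNReal.coe_lt_coe] using ht)
  rw [zero_add] at hsum
  refine hsum.congr_fun fun n => ?_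
  simp only
  rw [cauchyPowerSeries_apply, contourIntegral_eq_circleIntegral (C := C / A ^ (n + 1)) hA hAa hδ]
  · simp only [sub_zero, smul_eq_mul, one_div]
    rw [mul_assoc, mul_comm _ (t ^ n), ← circleIntegral.integral_const_mul]
    congr 1
    refine congrArg (fun f => circleIntegral f 0 A) (funext fun z => ?_)
    rw [div_pow, pow_succ, div_eq_mul_inv, div_eq_mul_inv, mul_inv]
    ring
  · refine DifferentiableOn.div (hh.mono sdiff_subset) (by fun_prop) fun z hz => ?_
    exact pow_ne_zero _ hz.2
  · intro ξ hξ hAξ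
    rw [norm_div, norm_pow, div_mul_eq_mul_div]
    have h1 := hb ξ hξ
    have h0 : 0 ≤ C * Real.exp (-δ * ‖ξ‖) := (norm_nonneg _).trans h1
    gcongr

/-! ### The series for the fractional derivative -/

lemma sub_le_re_of_mem_region {A : ℝ} {ξ : ℂ} (hξ : ξ ∈ region A) : ‖ξ‖ - 2 * A ≤ ξ.re := by
  have hξ : Metric.infDist _ _ < A := hξ
  rcases le_total 0 ξ.re with h | h
  · rw [infDist_ray_of_nonneg h] at hξ
    have := norm_le_abs_re_add_abs_im ξ
    rw [abs_of_nonneg h] at this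
    linarith [abs_nonneg ξ.im]
  · rw [infDist_ray_of_nonpos h] at hξ
    linarith [(abs_le.1 (abs_re_le_norm ξ)).1]

lemma HasType.exists_decay {a R : ℝ} (hR : 0 ≤ R) {F : ℂ → ℂ} (hF : HasType a R F) {r : ℝ}
    (hr : R < r) {A : ℝ} (hA : 0 < A) (hAa : A < a) :
    ∃ C δ : ℝ, 0 < δ ∧ ∀ ξ ∈ region A, ‖F ξ * exp (-r * ξ)‖ ≤ C * Real.exp (-δ * ‖ξ‖) := by
  obtain ⟨C, hC⟩ := hF.bound ((R + r) / 2) (by linarith) A hA hAa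
  refine ⟨C * Real.exp (2 * r * A), (r - R) / 2, by linarith, fun ξ hξ => ?_⟩
  have h1 := sub_le_re_of_mem_region hξ
  have h2 := hC ξ hξ
  rw [norm_mul, norm_exp, ← ofReal_neg, re_ofReal_mul]
  calc ‖F ξ‖ * Real.exp (-r * ξ.re)
      ≤ (C * Real.exp ((R + r) / 2 * ‖ξ‖)) * Real.exp (-r * (‖ξ‖ - 2 * A)) := by
        have h3 : -r * ξ.re ≤ -r * (‖ξ‖ - 2 * A) := by nlinarith
        have h4 := (norm_nonneg _).trans h2
        gcongr
    _ = C * (Real.exp ((R + r) / 2 * ‖ξ‖) * Real.exp (-r * (‖ξ‖ - 2 * A))) := by ring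
    _ = C * (Real.exp (2 * r * A) * Real.exp (-((r - R) / 2) * ‖ξ‖)) := by
        rw [← Real.exp_add, ← Real.exp_add]; ring_nf
    _ = _ := by ring

/-- `(1 - t/ξ)^{-α-1}` is bounded for `ξ` on `γ(A)` and `t` in a bounded part of a smaller region;
as `Re α > -1`, only a lower bound for `|1 - t/ξ|` is needed. -/
lemma exists_tail_zero_bound {α : ℂ} (hα : -1 < α.re) {A A' ρ : ℝ} (hA : 0 < A) (hA' : A' < A)
    (hρ : 0 < ρ) : ∃ K, 0 ≤ K ∧ ∀ t ∈ region A' ∩ Metric.ball 0 ρ, ∀ ξ ∈ bdry A,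
      ‖tail α 0 (t / ξ)‖ ≤ K := by
  set m := min (1 / 2) ((A - A') / (2 * ρ)) with hm
  have hm0 : 0 < m := lt_min (by norm_num) (div_pos (by linarith) (by linarith))
  refine ⟨‖Gamma (α + 1)‖ * (m ^ (-(α + 1)).re * Real.exp (Real.pi * |α.im|)), by positivity,
    fun t ht ξ hξ => ?_⟩
  have htρ : ‖t‖ < ρ := by simpa using ht.2
  have hξ0 : 0 < ‖ξ‖ := hA.trans_le (le_norm_of_mem_bdry hξ)
  have hξne : ξ ≠ 0 := norm_pos_iff.1 hξ0
  have hlow : m ≤ ‖1 - t / ξ‖ := by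
    rcases le_or_gt ‖ξ‖ (2 * ρ) with h | h
    · refine (min_le_right _ _).trans ?_
      have e : 1 - t / ξ = (ξ - t) / ξ := by field_simp
      rw [e, norm_div]
      have := sub_le_norm_sub_of_mem_bdry hξ ht.1
      gcongr
    · refine (min_le_left _ _).trans ?_
      have h1 : ‖t / ξ‖ ≤ 1 / 2 := by
        rw [norm_div, div_le_iff₀ hξ0]; linarith
      have h2 := norm_sub_norm_le (1 : ℂ) (t / ξ)
      rw [norm_one] at h2
      linarith
  rw [tail, norm_mul]
  gcongr
  refine (norm_cpow_le _ _).trans ?_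
  rw [div_eq_mul_inv, ← Real.exp_neg]
  gcongr ?_ * Real.exp ?_
  · exact Real.rpow_le_rpow_of_nonpos hm0 hlow (by simp; linarith)
  · rw [neg_im, add_im, one_im, add_zero, mul_neg, neg_neg]
    calc arg (1 - t / ξ) * α.im ≤ |arg (1 - t / ξ) * α.im| := le_abs_self _
      _ ≤ _ := by
        rw [abs_mul]
        gcongr
        exact abs_arg_le_pi _

/-- The integrand `tail α k (t/ξ) h(ξ)/ξ` of the `k`-th term, for a weight `h` in place of
`F(ξ)e^{-rξ}`. -/
def kernel (α : ℂ) (h : ℂ → ℂ) (k : ℕ) (t ξ : ℂ) : ℂ := tail α k (t / ξ) * (h ξ / ξ)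

section Kernel

variable {α : ℂ} {a A : ℝ} {h : ℂ → ℂ}

lemma continuousOn_kernel (hA : 0 < A) (hh : ContinuousOn h (bdry A)) (k : ℕ) {t : ℂ}
    (ht : t ∈ region A) : ContinuousOn (kernel α h k t) (bdry A) := by
  have hid : ContinuousOn (fun ξ : ℂ => ξ) (bdry A) := continuousOn_id
  have hne : ∀ ξ ∈ bdry A, ξ ≠ 0 := fun ξ hξ => ne_zero_of_mem_bdry hA hξ
  exact ((differentiableOn_tail α k).continuousOn.comp (continuousOn_const.div hid hne)
    fun ξ hξ => div_mem_cutPlane hA hξ ht).mul (hh.div hid hne)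

lemma differentiableOn_kernel (hA : 0 < A) (k : ℕ) {ξ : ℂ} (hξ : ξ ∈ bdry A) :
    DifferentiableOn ℂ (fun t => kernel α h k t ξ) (region A) :=
  ((differentiableOn_tail α k).comp (differentiableOn_id.div_const ξ)
    fun _ ht => div_mem_cutPlane hA hξ ht).mul_const _

lemma exists_kernel_bound (hα : -1 < α.re) {A' ρ C δ : ℝ} (hA : 0 < A) (hA' : A' < A) (hρ : 0 < ρ)
    (hb : ∀ ξ ∈ bdry A, ‖h ξ‖ ≤ C * Real.exp (-δ * ‖ξ‖)) :
    ∃ K, ∀ k : ℕ, ∀ t ∈ region A' ∩ Metric.ball 0 ρ, ∀ ξ ∈ bdry A,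
      ‖kernel α h k t ξ‖ ≤ 2 ^ k * K * Real.exp (-δ * ‖ξ‖) := by
  obtain ⟨K, hK0, hK⟩ := exists_tail_zero_bound hα hA hA' hρ
  obtain ⟨D, hD0, hD⟩ := exists_tail_bound hα
  refine ⟨(K + D) * (C / A), fun k t ht ξ hξ => ?_⟩
  have h1 := hb ξ hξ
  have h2 := (norm_nonneg _).trans h1
  have h3 := le_norm_of_mem_bdry hξ
  rw [kernel, norm_mul, norm_div]
  calc ‖tail α k (t / ξ)‖ * (‖h ξ‖ / ‖ξ‖)
      ≤ (2 ^ k * (K + D)) * ((C * Real.exp (-δ * ‖ξ‖)) / A) := by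
        gcongr
        refine (hD k _).trans ?_
        gcongr
        exact hK t ht ξ hξ
    _ = _ := by ring

/-- Near `0` the integrals of the kernels have explicit Taylor series. -/
lemma hasSum_contourIntegral_kernel (hα : -1 < α.re) {C δ : ℝ} (hA : 0 < A) (hδ : 0 < δ)
    (hh : ContinuousOn h (bdry A)) (hb : ∀ ξ ∈ bdry A, ‖h ξ‖ ≤ C * Real.exp (-δ * ‖ξ‖)) (k : ℕ)
    {t : ℂ} (ht : ‖t‖ < A) :
    HasSum (fun n => mult α (n + k) * t ^ n * contourIntegral A (fun ξ => h ξ / ξ ^ (n + 1)))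
      (contourIntegral A (kernel α h k t)) := by
  have hid : ContinuousOn (fun ξ : ℂ => ξ) (bdry A) := continuousOn_id
  have hne : ∀ ξ ∈ bdry A, ξ ≠ 0 := fun ξ hξ => ne_zero_of_mem_bdry hA hξ
  have hq : ‖t‖ / A < 1 := (div_lt_one hA).2 ht
  have hq0 : 0 ≤ ‖t‖ / A := by positivity
  simp only [← contourIntegral_const_mul]
  refine hasSum_contourIntegral hA.le hδ
    (((hasTaylor_tail hα k).summable_norm hq0 hq).mul_right (C / A)) (fun n => ?_)
    (fun n ξ hξ => ?_) fun ξ hξ => ?_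
  · exact continuousOn_const.mul (hh.div (hid.pow _) fun ξ hξ => pow_ne_zero _ (hne ξ hξ))
  · have h1 := hb ξ hξ
    have h2 := (norm_nonneg _).trans h1
    have h3 := le_norm_of_mem_bdry hξ
    rw [norm_mul, norm_mul, norm_div, norm_pow, norm_pow]
    calc ‖mult α (n + k)‖ * ‖t‖ ^ n * (‖h ξ‖ / ‖ξ‖ ^ (n + 1))
        ≤ ‖mult α (n + k)‖ * ‖t‖ ^ n * ((C * Real.exp (-δ * ‖ξ‖)) / A ^ (n + 1)) := by gcongr
      _ = _ := by rw [div_pow, pow_succ]; field_simp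
  · have hξA := le_norm_of_mem_bdry hξ
    have hs := (hasTaylor_tail hα k (t / ξ) (by
      rw [mem_ball_zero_iff, norm_div, div_lt_one (hA.trans_le hξA)]
      exact ht.trans_le hξA)).mul_right (h ξ / ξ)
    refine hs.congr_fun fun n => ?_
    have := hne ξ hξ
    rw [div_pow, pow_succ]
    field_simp

/-- The `k`-th term of the series, for a weight `h` in place of `F(ξ)e^{-rξ}`. -/
def kernelTerm (α : ℂ) (A r : ℝ) (h : ℂ → ℂ) (k : ℕ) (t : ℂ) : ℂ :=
  (r * t) ^ k / k.factorial * (1 / (2 * Real.pi * I) * contourIntegral A (kernel α h k t))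

lemma exists_kernelTerm_bound (hα : -1 < α.re) {A' ρ C δ r : ℝ} (hA : 0 < A) (hA' : A' < A)
    (hρ : 0 < ρ) (hδ : 0 < δ) (hr : 0 ≤ r)
    (hb : ∀ ξ ∈ bdry A, ‖h ξ‖ ≤ C * Real.exp (-δ * ‖ξ‖)) :
    ∃ v : ℕ → ℝ, Summable v ∧ ∀ k : ℕ, ∀ t ∈ region A' ∩ Metric.ball 0 ρ,
      ‖kernelTerm α A r h k t‖ ≤ v k := by
  obtain ⟨K, hK⟩ := exists_kernel_bound hα hA hA' hρ hb
  obtain ⟨L, hL0, hL⟩ := exists_contourIntegral_bound hA.le hδ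
  refine ⟨fun k => (2 * (r * ρ)) ^ k / k.factorial * (‖(1 / (2 * Real.pi * I) : ℂ)‖ * (K * L)),
    (Real.summable_pow_div_factorial _).mul_right _, fun k t ht => ?_⟩
  have htρ : ‖t‖ < ρ := by simpa using ht.2
  have h1 := hL (2 ^ k * K) (kernel α h k t) (hK k t ht)
  rw [kernelTerm, norm_mul, norm_div, norm_pow, norm_mul, norm_real, Real.norm_of_nonneg hr,
    norm_mul, norm_natCast]
  calc (r * ‖t‖) ^ k / k.factorial * (‖(1 / (2 * Real.pi * I) : ℂ)‖ *
        ‖contourIntegral A (kernel α h k t)‖)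
      ≤ (r * ρ) ^ k / k.factorial * (‖(1 / (2 * Real.pi * I) : ℂ)‖ * (2 ^ k * K * L)) := by
        gcongr
    _ = _ := by simp only [mul_pow (2 : ℝ)]; ring

lemma differentiableOn_kernelTerm (hα : -1 < α.re) {A' ρ C δ r : ℝ} (hA : 0 < A) (hA' : A' < A)
    (hρ : 0 < ρ) (hδ : 0 < δ) (hh : ContinuousOn h (bdry A))
    (hb : ∀ ξ ∈ bdry A, ‖h ξ‖ ≤ C * Real.exp (-δ * ‖ξ‖)) (k : ℕ) :
    DifferentiableOn ℂ (kernelTerm α A r h k) (region A' ∩ Metric.ball 0 ρ) := by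
  obtain ⟨K, hK⟩ := exists_kernel_bound hα hA hA' hρ hb
  have hsub : region A' ∩ Metric.ball 0 ρ ⊆ region A :=
    inter_subset_left.trans (region_mono hA'.le)
  have := differentiableOn_contourIntegral hA.le hδ ((isOpen_region A').inter Metric.isOpen_ball)
    (f := kernel α h k) (fun t ht => continuousOn_kernel hA hh k (hsub ht))
    (fun ξ hξ => (differentiableOn_kernel hA k hξ).mono hsub) (hK k)
  exact DifferentiableOn.mul (by fun_prop) (this.const_mul _)

end Kernel

lemma hasSum_of_summable_prod {x : ℕ × ℕ → ℂ} (hx : Summable x) {f : ℕ → ℂ}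
    (hf : ∀ k, HasSum (fun n => x (k, n)) (f k)) :
    HasSum (fun N => ∑ p ∈ Finset.HasAntidiagonal.antidiagonal N, x p) (∑' k, f k) := by
  have h1 : ∑' k, f k = ∑' p, x p := (hx.hasSum.prod_fiberwise hf).tsum_eq
  rw [h1]
  have h2 := (Finset.HasAntidiagonal.sigmaAntidiagonalEquivProd (A := ℕ)).hasSum_iff.2 hx.hasSum
  refine h2.sigma fun N => ?_
  have := hasSum_fintype (fun p : Finset.HasAntidiagonal.antidiagonal N => x p)
  rwa [Finset.univ_eq_attach, Finset.sum_attach (Finset.HasAntidiagonal.antidiagonal N) x] at this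

/-- The Cauchy product of `e^{rt}` with a Taylor series. -/
lemma HasTaylor.exp_mul {A : ℝ} {c : ℕ → ℂ} {h : ℂ → ℂ} (hh : HasTaylor A c h) (r : ℂ) :
    HasTaylor A (fun N => ∑ p ∈ Finset.HasAntidiagonal.antidiagonal N,
        r ^ p.1 / p.1.factorial * c p.2)
      (fun t => exp (r * t) * h t) := by
  intro t ht
  have he : HasSum (fun k : ℕ => (r * t) ^ k / k.factorial) (exp (r * t)) := by
    rw [exp_eq_exp_ℂ]; exact NormedSpace.expSeries_div_hasSum_exp _
  have hx := summable_mul_of_summable_norm he.summable.norm (hh t ht).summable.norm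
  have := hasSum_of_summable_prod hx fun k => (hh t ht).mul_left ((r * t) ^ k / k.factorial)
  rw [tsum_mul_right, he.tsum_eq] at this
  refine this.congr_fun fun N => ?_
  rw [Finset.sum_mul]
  refine Finset.sum_congr rfl fun p hp => ?_
  rw [← Finset.HasAntidiagonal.mem_antidiagonal.1 hp, mul_pow, pow_add]
  ring

/-- Near `0` the series sums to the function with Taylor coefficients `Γ(α+n+1)/n! F_n`, where
`F_n` are those of `F(t) = e^{rt} h(t)`: its terms are double series, which are rearranged. -/
lemma tsum_kernelTerm_of_small {α : ℂ} (hα : -1 < α.re) {A C δ r : ℝ} {h : ℂ → ℂ} (hA : 0 < A)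
    (hδ : 0 < δ) (hh : ContinuousOn h (bdry A))
    (hb : ∀ ξ ∈ bdry A, ‖h ξ‖ ≤ C * Real.exp (-δ * ‖ξ‖))
    (hT : HasTaylor A (fun n => 1 / (2 * Real.pi * I) *
      contourIntegral A (fun ξ => h ξ / ξ ^ (n + 1))) h) {F G : ℂ → ℂ}
    (hF : ∀ t ∈ Metric.ball (0 : ℂ) A, F t = exp (r * t) * h t)
    (hG : ∀ u : ℕ → ℂ, HasTaylor A u F → HasTaylor A (fun n => mult α n * u n) G) {t : ℂ}
    (ht : ‖t‖ < A / 2) : ∑' k, kernelTerm α A r h k t = G t := by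
  have htA : t ∈ Metric.ball (0 : ℂ) A := by rw [mem_ball_zero_iff]; linarith
  set c : ℕ → ℂ := fun n => 1 / (2 * Real.pi * I) *
    contourIntegral A (fun ξ => h ξ / ξ ^ (n + 1)) with hc
  set x : ℕ × ℕ → ℂ := fun p =>
    (r * t) ^ p.1 / p.1.factorial * (mult α (p.2 + p.1) * t ^ p.2 * c p.2) with hx
  have hFT : HasTaylor A (fun N => ∑ p ∈ Finset.HasAntidiagonal.antidiagonal N,
      (r : ℂ) ^ p.1 / p.1.factorial * c p.2) F := by
    intro s hs
    rw [hF s hs]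
    exact hT.exp_mul r s hs
  obtain ⟨D, hD0, hD⟩ := exists_mult_bound hα
  have hxs : Summable x := by
    have s1 : Summable fun k : ℕ => D * ((3 / 2 * (|r| * ‖t‖)) ^ k / k.factorial) :=
      (Real.summable_pow_div_factorial _).mul_left D
    have s2 : Summable fun n : ℕ => ‖c n‖ * (3 / 2 * ‖t‖) ^ n :=
      hT.summable_norm (by positivity) (by linarith)
    refine Summable.of_norm_bounded (s1.mul_of_nonneg s2 (fun k => by positivity)
      fun n => by positivity) fun p => ?_
    simp only [hx, norm_mul, norm_div, norm_pow, norm_natCast, norm_real, Real.norm_eq_abs]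
    calc (|r| * ‖t‖) ^ p.1 / p.1.factorial * (‖mult α (p.2 + p.1)‖ * ‖t‖ ^ p.2 * ‖c p.2‖)
        ≤ (|r| * ‖t‖) ^ p.1 / p.1.factorial * (D * (3 / 2) ^ (p.2 + p.1) * ‖t‖ ^ p.2 *
          ‖c p.2‖) := by
          gcongr
          exact hD _
      _ = _ := by rw [mul_pow (3 / 2 : ℝ), mul_pow (3 / 2 : ℝ), pow_add]; ring
  have hfib : ∀ k, HasSum (fun n => x (k, n)) (kernelTerm α A r h k t) := by
    intro k
    have h1 := ((hasSum_contourIntegral_kernel hα hA hδ hh hb k (t := t)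
      (by linarith)).mul_left (1 / (2 * Real.pi * I) : ℂ)).mul_left ((r * t) ^ k / k.factorial : ℂ)
    refine h1.congr_fun fun n => ?_
    simp only [hx, hc]
    ring
  have hsum := hasSum_of_summable_prod hxs hfib
  refine hsum.unique ((hG _ hFT t htA).congr_fun fun N => ?_)
  simp only
  rw [Finset.mul_sum, Finset.sum_mul]
  refine Finset.sum_congr rfl fun p hp => ?_
  simp only [hx]
  rw [← Finset.HasAntidiagonal.mem_antidiagonal.1 hp, mul_pow, add_comm p.1 p.2, pow_add]
  ring

/-- The series converges absolutely to `G` throughout `𝔇(A)`, by the identity theorem. -/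
lemma hasSum_kernelTerm {α : ℂ} (hα : -1 < α.re) {A C δ r : ℝ} {h : ℂ → ℂ} (hA : 0 < A)
    (hδ : 0 < δ) (hr : 0 ≤ r) (hh : ContinuousOn h (bdry A))
    (hb : ∀ ξ ∈ bdry A, ‖h ξ‖ ≤ C * Real.exp (-δ * ‖ξ‖)) {G : ℂ → ℂ}
    (hGd : DifferentiableOn ℂ G (region A))
    (hsmall : ∀ t : ℂ, ‖t‖ < A / 2 → ∑' k, kernelTerm α A r h k t = G t) {t : ℂ}
    (ht : t ∈ region A) :
    Summable (fun k => ‖kernelTerm α A r h k t‖) ∧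
      HasSum (fun k => kernelTerm α A r h k t) (G t) := by
  have ht' : Metric.infDist t ((fun x : ℝ => (x : ℂ)) '' Ioi 0) < A := ht
  obtain ⟨A', hA'1, hA'2⟩ := exists_between ht'
  have hA'0 : 0 < A' := lt_of_le_of_lt Metric.infDist_nonneg hA'1
  have hρ : 0 < ‖t‖ + 1 := by positivity
  obtain ⟨v, hv, hvb⟩ := exists_kernelTerm_bound hα hA hA'2 hρ hδ hr hb
  have htV : t ∈ region A' ∩ Metric.ball 0 (‖t‖ + 1) := ⟨hA'1, by simp⟩
  have hs : Summable (fun k => ‖kernelTerm α A r h k t‖) :=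
    Summable.of_nonneg_of_le (fun _ => norm_nonneg _) (fun k => hvb k t htV) hv
  refine ⟨hs, ?_⟩
  have hVo : IsOpen (region A' ∩ Metric.ball (0 : ℂ) (‖t‖ + 1)) :=
    (isOpen_region A').inter Metric.isOpen_ball
  have hd := differentiableOn_tsum_of_summable_norm hv
    (fun k => differentiableOn_kernelTerm (r := r) hα hA hA'2 hρ hδ hh hb k) hVo hvb
  have heq : EqOn (fun t => ∑' k, kernelTerm α A r h k t) G
      (region A' ∩ Metric.ball (0 : ℂ) (‖t‖ + 1)) := by
    refine AnalyticOnNhd.eqOn_of_preconnected_of_eventuallyEq (z₀ := 0) (hd.analyticOnNhd hVo)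
      ((hGd.mono (inter_subset_left.trans (region_mono hA'2.le))).analyticOnNhd hVo)
      ((convex_region A').inter (convex_ball _ _)).isPreconnected
      ⟨zero_mem_region hA'0, by simpa using hρ⟩ ?_
    filter_upwards [Metric.ball_mem_nhds (0 : ℂ) (half_pos hA)] with s hs
    exact hsmall s (by simpa using hs)
  have := hs.of_norm.hasSum
  rwa [show ∑' k, kernelTerm α A r h k t = G t from heq htV] at this

lemma mult_mul_integrand {α : ℂ} (hα : -1 < α.re) {A r : ℝ} (hA : 0 < A) (F : ℂ → ℂ) (k : ℕ)
    {t ξ : ℂ} (ht : t ∈ region A) (hξ : ξ ∈ bdry A) :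
    mult α k * integrand F α r t k ξ = kernel α (fun ξ => F ξ * exp (-r * ξ)) k t ξ := by
  rw [integrand, kernel, ← mult_mul_gauss2F1 hα k (div_mem_cutPlane hA hξ ht)]
  ring

lemma seriesTerm_eq_kernelTerm {α : ℂ} (hα : -1 < α.re) {A r : ℝ} (hA : 0 < A) (F : ℂ → ℂ) (k : ℕ)
    {t : ℂ} (ht : t ∈ region A) :
    seriesTerm F A α r t k = kernelTerm α A r (fun ξ => F ξ * exp (-r * ξ)) k t := by
  have h1 : contourIntegral A (kernel α (fun ξ => F ξ * exp (-r * ξ)) k t) =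
      mult α k * contourIntegral A (integrand F α r t k) := by
    rw [← contourIntegral_const_mul]
    exact contourIntegral_congr hA.le fun ξ hξ => (mult_mul_integrand hα hA F k ht hξ).symm
  rw [seriesTerm, coeff, kernelTerm, h1, mult]
  field_simp

lemma absConvergent_integrand {α : ℂ} (hα : -1 < α.re) {A C δ r : ℝ} (hA : 0 < A) (hδ : 0 < δ)
    {F : ℂ → ℂ} (hF : ContinuousOn F (bdry A))
    (hb : ∀ ξ ∈ bdry A, ‖F ξ * exp (-r * ξ)‖ ≤ C * Real.exp (-δ * ‖ξ‖)) {t : ℂ}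
    (ht : t ∈ region A) (k : ℕ) : AbsConvergent A (integrand F α r t k) := by
  have ht' : Metric.infDist t ((fun x : ℝ => (x : ℂ)) '' Ioi 0) < A := ht
  obtain ⟨A', hA'1, hA'2⟩ := exists_between ht'
  obtain ⟨K, hK⟩ := exists_kernel_bound hα hA hA'2 (show 0 < ‖t‖ + 1 by positivity) hb
  have hm := mult_ne_zero hα k
  have heq : EqOn (integrand F α r t k)
      (fun ξ => (mult α k)⁻¹ * kernel α (fun ξ => F ξ * exp (-r * ξ)) k t ξ) (bdry A) := by
    intro ξ hξ
    simp only
    rw [← mult_mul_integrand hα hA F k ht hξ, inv_mul_cancel_left₀ hm]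
  refine absConvergent_of_bound hA.le hδ (C := ‖(mult α k)⁻¹‖ * (2 ^ k * K)) ?_ fun ξ hξ => ?_
  · exact (continuousOn_const.mul (continuousOn_kernel hA
      (hF.mul (by fun_prop)) k ht)).congr heq
  · rw [heq hξ, norm_mul, mul_assoc]
    gcongr
    exact hK k t ⟨hA'1, by simp⟩ ξ hξ

lemma HasType.congr {a R : ℝ} {F G : ℂ → ℂ} (hF : HasType a R F) (h : EqOn G F (region a)) :
    HasType a R G where
  diff := hF.diff.congr h
  bound r hr A hA hAa := by
    obtain ⟨C, hC⟩ := hF.bound r hr A hA hAa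
    refine ⟨C, fun t ht => ?_⟩
    rw [h (region_mono hAa.le ht)]
    exact hC t ht

end FracCalc
end

theorem theorem6 (a R : ℝ) (ha : 0 < a) (hR : 0 ≤ R) (α : ℂ) (hα : -1 < α.re)
    (F : ℂ → ℂ) (hF : FracCalc.MemH a R F) :
    (∀ r : ℝ, R < r → ∀ A : ℝ, 0 < A → A < a → ∀ t ∈ FracCalc.region A,
      (∀ k : ℕ, FracCalc.AbsConvergent A (FracCalc.integrand F α r t k)) ∧
      Summable (fun k : ℕ => ‖FracCalc.seriesTerm F A α r t k‖) ∧
      HasSum (fun k : ℕ => FracCalc.seriesTerm F A α r t k) (FracCalc.fracDeriv α F t)) ∧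
    FracCalc.MemH a R (FracCalc.fracDeriv α F) ∧
    (∀ ζ : ℂ, R < ζ.re →
      FracCalc.laplace (FracCalc.fracDeriv α F) ζ = FracCalc.laplaceAlpha α F ζ) := by
  open FracCalc in
  have hFT := hF.hasType hR
  obtain ⟨G, hG, hGL, hGT⟩ := hFT.exists_fracDeriv ha hR hα
  have heq : Set.EqOn (fracDeriv α F) G (region a) :=
    IsFracDeriv.fracDeriv_eq ⟨ha, hR, hG.memH, R, hGL⟩
  refine ⟨fun r hr A hA hAa t ht => ?_, (hG.congr heq).memH, fun ζ hζ => ?_⟩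
  · have hr0 : 0 ≤ r := hR.trans hr.le
    obtain ⟨C, δ, hδ, hC⟩ := hFT.exists_decay hR hr (A := (A + a) / 2) (by linarith) (by linarith)
    have hA' : A < (A + a) / 2 := by linarith
    have hb : ∀ ξ ∈ bdry A, ‖F ξ * Complex.exp (-r * ξ)‖ ≤ C * Real.exp (-δ * ‖ξ‖) :=
      fun ξ hξ => hC ξ (bdry_subset_region hA' hξ)
    have hFc : ContinuousOn F (bdry A) := hFT.diff.continuousOn.mono (bdry_subset_region hAa)
    have hh : ContinuousOn (fun ξ => F ξ * Complex.exp (-r * ξ)) (bdry A) :=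
      hFc.mul (by fun_prop)
    have hT := hasTaylor_contourIntegral hA hA' hδ (h := fun ξ => F ξ * Complex.exp (-r * ξ))
      ((hFT.diff.mono (region_mono (by linarith))).mul (by fun_prop)) hC
    have hs := hasSum_kernelTerm hα hA hδ hr0 hh hb (hG.diff.mono (region_mono hAa.le))
      (fun s hs => tsum_kernelTerm_of_small hα hA hδ hh hb hT (F := F) (fun z _ => by
        rw [mul_left_comm, ← Complex.exp_add]; simp) (hGT A) hs) ht
    simp only [seriesTerm_eq_kernelTerm hα hA F _ ht, heq (region_mono hAa.le ht)]
    exact ⟨fun k => absConvergent_integrand hα hA hδ hFc hb ht k, hs⟩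
  · rw [← hGL ζ hζ, laplace, laplace]
    congr 1
    refine MeasureTheory.setIntegral_congr_fun measurableSet_Ioi fun t ht => ?_
    rw [heq (ofReal_mem_region ha (le_of_lt ht))]
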